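/- **Setting.** For a finite connected graph $G$, let $M_G$ be the group generated by the vertices $v_j$, the directed edges $e_{jk}$ and the central phases $\pm1,\pm i$, subject to $e_{jk}^2=v_j^2=1$, $e_{jk}=-e_{kj}$, where the generators commute except that $e_{jk}$ anticommutes with $v_j$ and $v_k$, and two edges sharing exactly one vertex anticommute. Let $\mathcal C_G\le M_G$ be the group of elements $i^{n}e_{j_1j_2}e_{j_2j_3}\cdots e_{j_nj_1}$ attached to closed walks with $n$ edges. A fermionic encoding is a homomorphism $\sigma$ from $M_G$ to the Pauli group on $N$ qubits that sends phases to the same phases and satisfies $-1\notin S:=\sigma(\mathcal C_G)$. Its disparity is $\Delta=N-M-D(S)$, where $M$ is the number of vertices of $G$ and $D(S)$ is the minimal number of generators of $S$. A 6.4.3.4 lattice is a finite set of faces (hexagons, squares, triangles) of the 6.4.3.4 uniform tiling; its fermionic graph consists of the vertices and sides of these faces. It has no holes if any two faces of the tiling outside it are joined by a chain of faces outside it in which consecutive faces share a side. The encoding has one qubit for each vertex and one for each square of the lattice. Orient the sides of hexagons counterclockwise and the sides of triangles clockwise. Then $\sigma(v_j)=Z_j$, and for an edge oriented from $j$ to $k$,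 $\sigma(e_{jk})=\pm X_jY_kP_f$, where $f$ is the unique square of the tiling having the edge as a side, $P=X$ if the edge is a side of a hexagon and $P=Y$ if it is a side of a triangle, and $P_f$ is omitted if $f$ is not in the lattice. The signs are chosen so that $\sigma$ is a fermionic encoding. **Proposition.** Consider a 6.4.3.4 lattice whose fermionic graph is connected, which has no holes, in which every hexagonal face is fully surrounded (all squares and triangles of the tiling that share a vertex with it belong to the lattice), and which consists only of hexagonal faces and of the squares and triangles surrounding them. Then signs as above exist, and for every such choice of signs the disparity of the encoding is $$\Delta=-1.$$ -/

import Mathlib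

namespace FermionEncoding

/-! ## The multi-qubit Pauli group -/

/-- The four single-qubit Pauli operators. -/
inductive Pauli : Type
  | I | X | Y | Z
  deriving DecidableEq

namespace Pauli

instance : Fintype Pauli := ⟨{I, X, Y, Z}, fun p => by cases p <;> decide⟩

/-- The product of two Pauli operators, up to a phase. -/
def mulOp : Pauli → Pauli → Pauli
  | I, p => p
  | p, I => p
  | X, X => I
  | Y, Y => I
  | Z, Z => I
  | X, Y => Z
  | Y, X => Z
  | Y, Z => X
  | Z, Y => X
  | Z, X => Y
  | X, Z => Y

/-- The exponent `a` of the phase `i ^ a` in the product of two Pauli operators. -/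
def mulPhase : Pauli → Pauli → ZMod 4
  | X, Y => 1
  | Y, Z => 1
  | Z, X => 1
  | Y, X => 3
  | Z, Y => 3
  | X, Z => 3
  | _, _ => 0

/-- The Pauli matrices. -/
def toMatrix : Pauli → Matrix (Fin 2) (Fin 2) ℂ
  | I => !![1, 0; 0, 1]
  | X => !![0, 1; 1, 0]
  | Y => !![0, -Complex.I; Complex.I, 0]
  | Z => !![1, 0; 0, -1]

/-- The multiplication table above is the one of the Pauli matrices. -/
theorem toMatrix_mul (p q : Pauli) :
    p.toMatrix * q.toMatrix = Complex.I ^ (mulPhase p q).val • (mulOp p q).toMatrix := by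
  have h1 : (1 : ZMod 4).val = 1 := rfl
  have h3 : (3 : ZMod 4).val = 3 := rfl
  have hI : Complex.I ^ 3 = -Complex.I := by
    rw [pow_succ, Complex.I_sq]; ring
  cases p <;> cases q <;> ext a b <;> fin_cases a <;> fin_cases b <;>
    simp [toMatrix, mulPhase, mulOp, h1, h3, hI, Matrix.mul_apply, Fin.sum_univ_two]

theorem mulOp_assoc (p q r : Pauli) : mulOp (mulOp p q) r = mulOp p (mulOp q r) := by
  cases p <;> cases q <;> cases r <;> rfl

theorem mulPhase_assoc (p q r : Pauli) :
    mulPhase p q + mulPhase (mulOp p q) r = mulPhase q r + mulPhase p (mulOp q r) := by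
  cases p <;> cases q <;> cases r <;> rfl

end Pauli

/-- The Pauli group `{±1, ±i} × ∏_q {I_q, X_q, Y_q, Z_q}` on the qubits `q : Q`. The element
`⟨a, p⟩` is the operator `i ^ a • ⨂_q p q`. -/
@[ext]
structure PauliGroup (Q : Type) where
  phase : ZMod 4
  op : Q → Pauli

namespace PauliGroup

variable {Q : Type}

instance [Fintype Q] : Mul (PauliGroup Q) :=
  ⟨fun a b => ⟨a.phase + b.phase + ∑ q, Pauli.mulPhase (a.op q) (b.op q),
    fun q => Pauli.mulOp (a.op q) (b.op q)⟩⟩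

instance : One (PauliGroup Q) := ⟨⟨0, fun _ => Pauli.I⟩⟩

instance : Inv (PauliGroup Q) := ⟨fun a => ⟨-a.phase, a.op⟩⟩

@[simp] theorem mul_phase [Fintype Q] (a b : PauliGroup Q) :
    (a * b).phase = a.phase + b.phase + ∑ q, Pauli.mulPhase (a.op q) (b.op q) := rfl

@[simp] theorem mul_op [Fintype Q] (a b : PauliGroup Q) (q : Q) :
    (a * b).op q = Pauli.mulOp (a.op q) (b.op q) := rfl

@[simp] theorem one_phase : (1 : PauliGroup Q).phase = 0 := rfl

@[simp] theorem one_op (q : Q) : (1 : PauliGroup Q).op q = Pauli.I := rfl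

@[simp] theorem inv_phase (a : PauliGroup Q) : (a⁻¹).phase = -a.phase := rfl

@[simp] theorem inv_op (a : PauliGroup Q) (q : Q) : (a⁻¹).op q = a.op q := rfl

instance [Fintype Q] : Group (PauliGroup Q) :=
  Group.ofLeftAxioms
    (by
      intro a b c
      apply PauliGroup.ext
      · have h : ∑ q, Pauli.mulPhase (a.op q) (b.op q) +
            ∑ q, Pauli.mulPhase (Pauli.mulOp (a.op q) (b.op q)) (c.op q) =
            ∑ q, Pauli.mulPhase (b.op q) (c.op q) +
            ∑ q, Pauli.mulPhase (a.op q) (Pauli.mulOp (b.op q) (c.op q)) := by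
          rw [← Finset.sum_add_distrib, ← Finset.sum_add_distrib]
          exact Finset.sum_congr rfl fun q _ => Pauli.mulPhase_assoc _ _ _
        simp only [mul_phase, mul_op]
        linear_combination h
      · funext q
        exact Pauli.mulOp_assoc _ _ _)
    (by
      intro a
      apply PauliGroup.ext
      · have h : ∀ p, Pauli.mulPhase Pauli.I p = 0 := by
          intro p; cases p <;> rfl
        simp [h]
      · funext q
        rfl)
    (by
      intro a
      apply PauliGroup.ext
      · have h : ∀ p, Pauli.mulPhase p p = 0 := by
          intro p; cases p <;> rfl
        simp [h]
      · funext q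
        change Pauli.mulOp (a.op q) (a.op q) = Pauli.I
        cases a.op q <;> rfl)

instance [Fintype Q] : Finite (PauliGroup Q) := by
  classical
  have : Function.Injective
      (fun a : PauliGroup Q => ((a.phase, a.op) : ZMod 4 × (Q → Pauli))) := by
    intro a b h
    exact PauliGroup.ext (congrArg Prod.fst h) (congrArg Prod.snd h)
  have : Finite (ZMod 4) := inferInstanceAs (Finite (Fin 4))
  exact Finite.of_injective _ ‹_›

/-- The scalar operator `i ^ a`; in particular `scalar 2` is `-1`. -/
def scalar (Q : Type) (a : ZMod 4) : PauliGroup Q := ⟨a, fun _ => Pauli.I⟩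

end PauliGroup

/-! ## The group of a fermionic graph, encodings and their disparity -/

section Graph

variable {V : Type} (G : SimpleGraph V)

/-- The generators of `M_G`: the vertices, the directed edges and the phases `i ^ a`. -/
inductive Generator : Type
  | vertex (v : V)
  | edge (d : G.Dart)
  | phase (a : ZMod 4)

/-- The relators of `M_G`. An equation `x = y` is given by the relator `x * y⁻¹`; `phase 2` is
`-1`, so that `x y = - y x` reads `x * y * (phase 2 * y * x)⁻¹`. -/
inductive Relator : FreeGroup (Generator G) → Prop
  | phase_mul (a b : ZMod 4) :
      Relator (.of (.phase a) * .of (.phase b) * (.of (.phase (a + b)))⁻¹)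
  | phase_central (a : ZMod 4) (g : Generator G) :
      Relator (.of (.phase a) * .of g * (.of g * .of (.phase a))⁻¹)
  | edge_sq (d : G.Dart) : Relator (.of (.edge d) * .of (.edge d))
  | vertex_sq (v : V) : Relator (.of (.vertex v) * .of (.vertex v))
  | edge_symm (d : G.Dart) :
      Relator (.of (.edge d) * (.of (.phase 2) * .of (.edge d.symm))⁻¹)
  | vertex_vertex (i j : V) :
      Relator (.of (.vertex i) * .of (.vertex j) * (.of (.vertex j) * .of (.vertex i))⁻¹)
  | edge_vertex (d : G.Dart) (k : V) (h₁ : k ≠ d.fst) (h₂ : k ≠ d.snd) :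
      Relator (.of (.edge d) * .of (.vertex k) * (.of (.vertex k) * .of (.edge d))⁻¹)
  | edge_edge (d d' : G.Dart) (h₁ : d.fst ≠ d'.fst) (h₂ : d.fst ≠ d'.snd)
      (h₃ : d.snd ≠ d'.fst) (h₄ : d.snd ≠ d'.snd) :
      Relator (.of (.edge d) * .of (.edge d') * (.of (.edge d') * .of (.edge d))⁻¹)
  | edge_vertex_anti (d : G.Dart) :
      Relator (.of (.edge d) * .of (.vertex d.snd) *
        (.of (.phase 2) * .of (.vertex d.snd) * .of (.edge d))⁻¹)
  | edge_edge_anti (d d' : G.Dart) (h₁ : d.snd = d'.fst) (h₂ : d.fst ≠ d'.snd) :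
      Relator (.of (.edge d) * .of (.edge d') *
        (.of (.phase 2) * .of (.edge d') * .of (.edge d))⁻¹)

/-- The finitely presented group `M_G`. -/
abbrev MG : Type := PresentedGroup {w | Relator G w}

/-- The element of `M_G` given by a generator. -/
def MG.gen (g : Generator G) : MG G := PresentedGroup.of g

/-- The element `i ^ n e_{i_1 i_2} e_{i_2 i_3} ⋯ e_{i_n i_1}` of `M_G` attached to a closed walk
with `n` edges. -/
def cycleElement {v : V} (p : G.Walk v v) : MG G :=
  MG.gen G (.phase (p.length : ZMod 4)) * (p.darts.map fun d => MG.gen G (.edge d)).prod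

/-- The group of directed cycles `C_G`. -/
def cycleGroup : Subgroup (MG G) :=
  Subgroup.closure {c | ∃ (v : V) (p : G.Walk v v), c = cycleElement G p}

variable {G} {Q : Type} [Fintype Q]

/-- The group `S = σ(C_G)`. -/
def stabilizerGroup (σ : MG G →* PauliGroup Q) : Subgroup (PauliGroup Q) :=
  (cycleGroup G).map σ

/-- A representation of `M_G` by Pauli operators (phases acting as phases) is a fermionic encoding
if no element of `C_G` is mapped to `-1`. -/
structure IsEncoding (σ : MG G →* PauliGroup Q) : Prop where
  phase : ∀ a, σ (MG.gen G (.phase a)) = PauliGroup.scalar Q a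
  neg_one_notMem : PauliGroup.scalar Q 2 ∉ stabilizerGroup σ

/-- The disparity `Δ = N - M - D(S)`: the number of qubits, minus the number of modes, minus the
minimal number of generators of `S`. -/
noncomputable def disparity [Fintype V] (σ : MG G →* PauliGroup Q) : ℤ :=
  (Fintype.card Q : ℤ) - (Fintype.card V : ℤ) - (Group.rank (stabilizerGroup σ) : ℤ)

end Graph

/-! ## The 6.4.3.4 tiling

The hexagons are indexed by `ℤ × ℤ`, the hexagon `(a, b)` being the one with unit sides and
centre `(1 + √3) (a e^{iπ/6} + b e^{iπ/2})` in the complex plane. Its neighbour across the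
square in direction `π/6 + jπ/3` is `(a, b) + dir j`, for `j` modulo 6. Every vertex of the tiling
lies on exactly one hexagon; the vertex `(x, k)` is the corner of the hexagon `x` in direction
`(k + 1)π/3` from its centre, that is, between the directions of `dir k` and `dir (k + 1)`. -/

/-- The vertices of the tiling. -/
abbrev Vertex : Type := (ℤ × ℤ) × ZMod 6

/-- The displacements between neighbouring hexagons, in counterclockwise order. -/
def dir (j : ZMod 6) : ℤ × ℤ :=
  if j = 0 then (1, 0) else if j = 1 then (0, 1) else if j = 2 then (-1, 1)
  else if j = 3 then (-1, 0) else if j = 4 then (0, -1) else (1, -1)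

/-- The head of the arrow that starts at `v` and runs counterclockwise along a hexagon. -/
def hexNext (v : Vertex) : Vertex := (v.1, v.2 + 1)

/-- The head of the arrow that starts at `v` and runs clockwise along a triangle. -/
def triNext (v : Vertex) : Vertex := (v.1 + dir (v.2 + 1), v.2 + 4)

/-- The graph of the 6.4.3.4 tiling: every edge is a side of a unique hexagon or of a unique
triangle. -/
def tiling : SimpleGraph Vertex :=
  SimpleGraph.fromRel fun u w => w = hexNext u ∨ w = triNext u

/-- The hexagon `x`; a face is given by the set of its vertices. -/
def hexagon (x : ℤ × ℤ) : Finset Vertex := Finset.univ.image fun k : ZMod 6 => (x, k)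

/-- The square between the hexagons `x` and `x + dir j`. -/
def square (x : ℤ × ℤ) (j : ZMod 6) : Finset Vertex :=
  {(x, j - 1), (x, j), (x + dir j, j + 2), (x + dir j, j + 3)}

/-- The triangle between the hexagons `x`, `x + dir k` and `x + dir (k + 1)`. -/
def triangle (x : ℤ × ℤ) (k : ZMod 6) : Finset Vertex :=
  {(x, k), (x + dir k, k + 2), (x + dir (k + 1), k + 4)}

def IsHexagon (f : Finset Vertex) : Prop := ∃ x, f = hexagon x

def IsSquare (f : Finset Vertex) : Prop := ∃ x j, f = square x j

def IsTriangle (f : Finset Vertex) : Prop := ∃ x k, f = triangle x k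

/-- The (bounded) faces of the tiling. -/
def IsFace (f : Finset Vertex) : Prop := IsHexagon f ∨ IsSquare f ∨ IsTriangle f

/-- Two different faces are adjacent if they have a common side. -/
def faceAdjacency : SimpleGraph (Finset Vertex) :=
  SimpleGraph.fromRel fun f g => ∃ u w, tiling.Adj u w ∧ u ∈ f ∧ w ∈ f ∧ u ∈ g ∧ w ∈ g

/-! ## Finite 6.4.3.4 lattices

A finite lattice is given by the finite set `F` of its faces. -/

/-- The vertices of the lattice: those of its faces. -/
abbrev LatticeVertex (F : Finset (Finset Vertex)) : Type := {v : Vertex // v ∈ F.biUnion id}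

/-- The fermionic graph of the lattice: its edges are the sides of its faces. -/
def latticeGraph (F : Finset (Finset Vertex)) : SimpleGraph (LatticeVertex F) where
  Adj u w := tiling.Adj u.1 w.1 ∧ ∃ f ∈ F, u.1 ∈ f ∧ w.1 ∈ f
  symm := ⟨fun _ _ ⟨h, f, hf, hu, hw⟩ => ⟨h.symm, f, hf, hw, hu⟩⟩
  loopless := ⟨fun _ ⟨h, _⟩ => h.ne rfl⟩

/-- Every hexagon of the lattice is fully surrounded: the squares and triangles around it (the
faces of the tiling that share a vertex with it) belong to the lattice. -/
def HexagonsSurrounded (F : Finset (Finset Vertex)) : Prop :=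
  ∀ h ∈ F, IsHexagon h → ∀ f, IsFace f → (f ∩ h).Nonempty → f ∈ F

/-- The lattice consists only of hexagons and of faces that surround its hexagons. -/
def MadeOfHexagons (F : Finset (Finset Vertex)) : Prop :=
  ∀ f ∈ F, ∃ h ∈ F, IsHexagon h ∧ (f ∩ h).Nonempty

/-- The lattice has no holes: the region that it leaves uncovered is connected, that is, any two
faces outside it are joined by a chain of faces outside it, each adjacent to the next. -/
def NoHoles (F : Finset (Finset Vertex)) : Prop :=
  (faceAdjacency.induce {f | IsFace f ∧ f ∉ F}).Preconnected

/-! ## The encoding -/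

/-- The qubits: one for every vertex, and one for every square face of the lattice. -/
abbrev Qubit (F : Finset (Finset Vertex)) : Type :=
  LatticeVertex F ⊕ {f : F // IsSquare f.1}

noncomputable instance (F : Finset (Finset Vertex)) : Fintype {f : F // IsSquare f.1} :=
  Fintype.ofFinite _

open Classical in
/-- The Pauli string `Z_v`. -/
noncomputable def vertexString (F : Finset (Finset Vertex)) (v : LatticeVertex F) :
    Qubit F → Pauli
  | .inl u => if u = v then .Z else .I
  | .inr _ => .I

open Classical in
/-- The Pauli string `X_u Y_w P_f` of an arrow from `u` to `w`, where `f` is the square that has the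
edge as a side. Both arrows that start at `u` are sides of the square between the hexagon of `u` and
its neighbour in direction `u.2 + 1`. If that square is not in the lattice, `P_f` is omitted. -/
noncomputable def edgeString (F : Finset (Finset Vertex)) (u w : LatticeVertex F) (P : Pauli) :
    Qubit F → Pauli
  | .inl v => if v = u then .X else if v = w then .Y else .I
  | .inr f => if f.1.1 = square u.1.1 (u.1.2 + 1) then P else .I

/-- The encoding of the 6.4.3.4 lattice: vertex operators are `Z_v`; edges along hexagons are
oriented counterclockwise and act on the qubit of their square by `X`; edges along triangles are
oriented clockwise and act on the qubit of their square by `Y`. The signs of the edge operators are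
arbitrary as long as the result is an encoding. -/
structure IsLatticeEncoding (F : Finset (Finset Vertex))
    (σ : MG (latticeGraph F) →* PauliGroup (Qubit F)) : Prop where
  isEncoding : IsEncoding σ
  vertex : ∀ v, σ (MG.gen _ (.vertex v)) = ⟨0, vertexString F v⟩
  hexEdge : ∀ d : (latticeGraph F).Dart, d.snd.1 = hexNext d.fst.1 →
    ∃ s : ZMod 4, (s = 0 ∨ s = 2) ∧
      σ (MG.gen _ (.edge d)) = ⟨s, edgeString F d.fst d.snd .X⟩
  triEdge : ∀ d : (latticeGraph F).Dart, d.snd.1 = triNext d.fst.1 →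
    ∃ s : ZMod 4, (s = 0 ∨ s = 2) ∧
      σ (MG.gen _ (.edge d)) = ⟨s, edgeString F d.fst d.snd .Y⟩

end FermionEncoding

open FermionEncoding

/-!
Let `c` be the number of connected components of a graph with `M` vertices and `E` edges. Up to
sign, the element of `C_G` attached to a closed walk depends only on its chain modulo 2, and the
Jordan–Wigner representation shows that `-1` is not in `C_G`. Hence an encoding `σ` identifies `S`
with the image of the cycle space under the linear map that sends a chain to the exponents of `X`
and `Z` in the product of its edge operators. An edge operator anticommutes with the vertex
operators of its endpoints only, so the commutation of a chain with the vertex operators reads off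
its boundary. The kernel of the linear map thus consists of cycles, and
`D(S) = E - M + c - dim ker`.

In a lattice with `s` squares, every vertex is the source of one arrow along a triangle and, if the
square of that arrow belongs to the lattice, of one arrow along a hexagon in the same square. As a
square contains two sources, `E = M + 2 s`, while `N = M + s`. A chain in the kernel contains with
an arrow the other arrow with the same source and, if its square belongs to the lattice, the other
arrow with the same target, so the kernel is spanned by the `s` squares. This gives
`D(S) = s + c` and `Δ = -c`. Conversely, edge operators with these commutation relations define an
encoding as soon as their signs make `σ` trivial on the squares, which span the kernel.
-/

namespace FermionEncoding

/-! ## Ranks of groups and spans modulo `p` -/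

section GroupRank

variable {Γ M : Type*} [Group Γ] [AddCommGroup M]

theorem mem_span_zmod_image_iff {n : ℕ} [Module (ZMod n) M] (L : Γ →* Multiplicative M) {T : Set Γ}
    {x : M} : x ∈ Submodule.span (ZMod n) ((fun g => (L g).toAdd) '' T) ↔
      ∃ g ∈ Subgroup.closure T, (L g).toAdd = x := by
  constructor
  · let W := AddSubgroup.toZModSubmodule n (Subgroup.toAddSubgroup' ((Subgroup.closure T).map L))
    suffices Submodule.span (ZMod n) ((fun g => (L g).toAdd) '' T) ≤ W from fun hx => this hx
    rw [Submodule.span_le]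
    rintro _ ⟨g, hg, rfl⟩
    exact ⟨g, Subgroup.subset_closure hg, rfl⟩
  · rintro ⟨g, hg, rfl⟩
    induction hg using Subgroup.closure_induction with
    | mem g hg => exact Submodule.subset_span ⟨g, hg, rfl⟩
    | one => simp
    | mul g h _ _ hg hh => simpa using add_mem hg hh
    | inv g _ hg => simpa using hg

variable {p : ℕ} [Fact p.Prime] [Module (ZMod p) M]

theorem finrank_span_le_rank [Group.FG Γ] (L : Γ →* Multiplicative M) :
    Module.finrank (ZMod p) (Submodule.span (ZMod p) (Set.range fun g => (L g).toAdd)) ≤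
      Group.rank Γ := by
  classical
  obtain ⟨t, ht, htop⟩ := Group.rank_spec Γ
  have hspan : Submodule.span (ZMod p) (Set.range fun g => (L g).toAdd) =
      Submodule.span (ZMod p) (t.image fun g => (L g).toAdd : Finset M) := by
    refine le_antisymm (Submodule.span_le.2 ?_) (Submodule.span_mono (by simp))
    rintro _ ⟨g, rfl⟩
    rw [Finset.coe_image, SetLike.mem_coe, mem_span_zmod_image_iff]
    exact ⟨g, htop ▸ Subgroup.mem_top g, rfl⟩
  rw [hspan, ← ht]
  exact (finrank_span_finset_le_card _).trans Finset.card_image_le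

theorem rank_le_finrank_span [Group.FG Γ] [FiniteDimensional (ZMod p) M]
    {L : Γ →* Multiplicative M} (hL : Function.Injective L) :
    Group.rank Γ ≤
      Module.finrank (ZMod p) (Submodule.span (ZMod p) (Set.range fun g => (L g).toAdd)) := by
  classical
  obtain ⟨b, hb, hspan, -⟩ :=
    Submodule.exists_fun_fin_finrank_span_eq (ZMod p) (Set.range fun g => (L g).toAdd)
  choose s hs using hb
  have hrange : Set.range b = (fun g => (L g).toAdd) '' Set.range s := by
    rw [← Set.range_comp]
    exact congrArg Set.range (funext fun i => (hs i).symm)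
  have htop : Subgroup.closure (Finset.univ.image s : Set Γ) = ⊤ := by
    rw [eq_top_iff, Finset.coe_image, Finset.coe_univ, Set.image_univ]
    intro g _
    have hg : (L g).toAdd ∈ Submodule.span (ZMod p) (Set.range b) := by
      rw [hspan]
      exact Submodule.subset_span ⟨g, rfl⟩
    rw [hrange, mem_span_zmod_image_iff] at hg
    obtain ⟨g', hg', h⟩ := hg
    rwa [← hL h]
  exact (Group.rank_le htop).trans (Finset.card_image_le.trans (by simp))

theorem rank_closure_eq_finrank_span [FiniteDimensional (ZMod p) M] (L : Γ →* Multiplicative M)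
    {T : Set Γ} [Group.FG (Subgroup.closure T)] (hL : Set.InjOn L (Subgroup.closure T)) :
    Group.rank (Subgroup.closure T) =
      Module.finrank (ZMod p) (Submodule.span (ZMod p) ((fun g => (L g).toAdd) '' T)) := by
  have hspan : Submodule.span (ZMod p) ((fun g => (L g).toAdd) '' T) = Submodule.span (ZMod p)
      (Set.range fun g : Subgroup.closure T => (L.comp (Subgroup.closure T).subtype g).toAdd) := by
    refine le_antisymm (Submodule.span_mono ?_) (Submodule.span_le.2 ?_)
    · rintro _ ⟨g, hg, rfl⟩
      exact ⟨⟨g, Subgroup.subset_closure hg⟩, rfl⟩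
    · rintro _ ⟨g, rfl⟩
      exact (mem_span_zmod_image_iff L).2 ⟨g, g.2, rfl⟩
  have hinj : Function.Injective (L.comp (Subgroup.closure T).subtype) := hL.injective
  rw [hspan]
  exact le_antisymm (rank_le_finrank_span hinj) (finrank_span_le_rank _)

end GroupRank

theorem finrank_map_add_finrank_ker {K M N : Type*} [Field K] [AddCommGroup M] [Module K M]
    [FiniteDimensional K M] [AddCommGroup N] [Module K N] (f : M →ₗ[K] N) {p : Submodule K M}
    (h : LinearMap.ker f ≤ p) :
    Module.finrank K (p.map f) + Module.finrank K (LinearMap.ker f) = Module.finrank K p := by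
  rw [← LinearMap.finrank_range_add_finrank_ker (f.domRestrict p), LinearMap.range_domRestrict,
    LinearMap.ker_domRestrict, (Submodule.comapSubtypeEquivOfLe h).finrank_eq]

/-! ## The symplectic form on the Pauli group -/

/-- The embedding of `ℤ/2` in `ℤ/4`; the phase of the sign `(-1) ^ x` is `double x`. -/
def double : ZMod 2 →+ ZMod 4 where
  toFun x := if x = 0 then 0 else 2
  map_zero' := rfl
  map_add' := by decide

theorem double_injective : Function.Injective double := by decide

namespace Pauli

/-- The exponent of `X` when a Pauli operator is written as `X ^ x * Z ^ z` up to a phase. -/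
def xBit : Pauli → ZMod 2
  | I => 0
  | X => 1
  | Y => 1
  | Z => 0

/-- The exponent of `Z` when a Pauli operator is written as `X ^ x * Z ^ z` up to a phase. -/
def zBit : Pauli → ZMod 2
  | I => 0
  | X => 0
  | Y => 1
  | Z => 1

/-- The symplectic form on single-qubit Pauli operators: `1` if they anticommute, `0` if they
commute. -/
def form (p q : Pauli) : ZMod 2 := p.xBit * q.zBit + p.zBit * q.xBit

theorem form_comm (p q : Pauli) : form p q = form q p := by
  cases p <;> cases q <;> rfl

theorem xBit_mulOp (p q : Pauli) : (mulOp p q).xBit = p.xBit + q.xBit := by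
  cases p <;> cases q <;> rfl

theorem zBit_mulOp (p q : Pauli) : (mulOp p q).zBit = p.zBit + q.zBit := by
  cases p <;> cases q <;> rfl

theorem eq_I_of_bits {p : Pauli} (hx : p.xBit = 0) (hz : p.zBit = 0) : p = I := by
  cases p <;> simp_all [xBit, zBit]

theorem mulPhase_swap (p q : Pauli) : mulPhase p q = mulPhase q p + double (form p q) := by
  cases p <;> cases q <;> rfl

theorem mulOp_comm (p q : Pauli) : mulOp p q = mulOp q p := by
  cases p <;> cases q <;> rfl

theorem mulOp_self (p : Pauli) : mulOp p p = I := by cases p <;> rfl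

theorem mulPhase_self (p : Pauli) : mulPhase p p = 0 := by cases p <;> rfl

@[simp] theorem mulOp_I_left (p : Pauli) : mulOp I p = p := by cases p <;> rfl

@[simp] theorem mulOp_I_right (p : Pauli) : mulOp p I = p := by cases p <;> rfl

@[simp] theorem mulPhase_I_left (p : Pauli) : mulPhase I p = 0 := by cases p <;> rfl

@[simp] theorem mulPhase_I_right (p : Pauli) : mulPhase p I = 0 := by cases p <;> rfl

end Pauli

namespace PauliGroup

variable {Q : Type}

/-- The bit vector of a Pauli string: its exponents of `X` and `Z` at every qubit. -/
def opBits (s : Q → Pauli) : Q → ZMod 2 × ZMod 2 := fun q => ((s q).xBit, (s q).zBit)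

variable [Fintype Q]

/-- The bit vector of a Pauli operator, a homomorphism whose kernel consists of the scalars. -/
def bits : PauliGroup Q →* Multiplicative (Q → ZMod 2 × ZMod 2) where
  toFun a := Multiplicative.ofAdd (opBits a.op)
  map_one' := rfl
  map_mul' a b := congrArg Multiplicative.ofAdd <| funext fun q =>
    Prod.ext (Pauli.xBit_mulOp (a.op q) (b.op q)) (Pauli.zBit_mulOp (a.op q) (b.op q))

theorem eq_scalar_of_bits {a : PauliGroup Q} (h : a.bits = 1) : a = scalar Q a.phase := by
  refine PauliGroup.ext rfl (funext fun q => ?_)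
  have hq : opBits a.op q = 0 := congrFun (congrArg Multiplicative.toAdd h) q
  exact Pauli.eq_I_of_bits (congrArg Prod.fst hq) (congrArg Prod.snd hq)

/-- The symplectic form on Pauli operators: `1` if they anticommute, `0` if they commute. -/
def form (a b : PauliGroup Q) : ZMod 2 := ∑ q, Pauli.form (a.op q) (b.op q)

theorem scalar_mul (c : ZMod 4) (a : PauliGroup Q) : scalar Q c * a = ⟨c + a.phase, a.op⟩ := by
  ext <;> simp [scalar]

theorem mul_scalar (c : ZMod 4) (a : PauliGroup Q) : a * scalar Q c = ⟨c + a.phase, a.op⟩ := by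
  ext <;> simp [scalar, add_comm]

theorem scalar_comm (c : ZMod 4) (a : PauliGroup Q) : scalar Q c * a = a * scalar Q c := by
  rw [scalar_mul, mul_scalar]

theorem scalar_mul_scalar (c d : ZMod 4) : scalar Q c * scalar Q d = scalar Q (c + d) :=
  scalar_mul c _

theorem mul_eq_scalar_of_op_eq {a b : PauliGroup Q} (h : a.op = b.op) :
    a * b = scalar Q (a.phase + b.phase) := by
  ext <;> simp [h, scalar, Pauli.mulPhase_self, Pauli.mulOp_self]

theorem mul_eq_form (a b : PauliGroup Q) : a * b = scalar Q (double (form a b)) * (b * a) := by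
  rw [scalar_mul]
  refine PauliGroup.ext ?_ (funext fun q => Pauli.mulOp_comm _ _)
  simp only [mul_phase, form, map_sum, Pauli.mulPhase_swap (a.op _) (b.op _),
    Finset.sum_add_distrib]
  ring

theorem form_eq_of_mul_eq {a b : PauliGroup Q} {r : ZMod 2}
    (h : a * b = scalar Q (double r) * (b * a)) : form a b = r := by
  rw [mul_eq_form, mul_left_inj] at h
  exact double_injective (congrArg phase h)

theorem commute_of_form_eq_zero {a b : PauliGroup Q} (h : form a b = 0) : a * b = b * a := by
  rw [mul_eq_form, h]
  exact one_mul _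

theorem anticommute_of_form_eq_one {a b : PauliGroup Q} (h : form a b = 1) :
    a * b = scalar Q 2 * b * a := by
  rw [mul_eq_form, h, mul_assoc]
  rfl

theorem form_comm (a b : PauliGroup Q) : form a b = form b a :=
  Finset.sum_congr rfl fun _ _ => Pauli.form_comm _ _

theorem form_scalar_mul_left (c : ZMod 4) (a b : PauliGroup Q) :
    form (scalar Q c * a) b = form a b := by
  rw [scalar_mul]
  rfl

theorem form_scalar_mul_right (c : ZMod 4) (a b : PauliGroup Q) :
    form a (scalar Q c * b) = form a b := by
  rw [scalar_mul]
  rfl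

theorem form_mul_left (a b c : PauliGroup Q) : form (a * b) c = form a c + form b c := by
  simp only [form, Pauli.form, mul_op, Pauli.xBit_mulOp, Pauli.zBit_mulOp,
    ← Finset.sum_add_distrib]
  exact Finset.sum_congr rfl fun q _ => by ring

theorem form_mul_right (a b c : PauliGroup Q) : form a (b * c) = form a b + form a c := by
  simp only [form_comm a, form_mul_left]

/-- The commutation form with `b`, as a linear function of the bits. -/
def pairing (b : PauliGroup Q) : (Q → ZMod 2 × ZMod 2) →ₗ[ZMod 2] ZMod 2 :=
  ∑ q, ((b.op q).zBit • LinearMap.fst _ _ _ + (b.op q).xBit • LinearMap.snd _ _ _) ∘ₗ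
    LinearMap.proj q

theorem pairing_bits (a b : PauliGroup Q) : pairing b a.bits.toAdd = form a b := by
  simp only [pairing, form, LinearMap.sum_apply]
  exact Finset.sum_congr rfl fun q _ =>
    (congrArg₂ (· + ·) (mul_comm _ _) (mul_comm _ _) : _ = (a.op q).form (b.op q))

end PauliGroup

/-! ## The cycle space -/

section CycleSpace

variable {V A : Type*} {G : SimpleGraph V}

/-- The indicator function modulo 2 of the endpoints of a dart. -/
def ends [DecidableEq V] (d : G.Dart) : V → ZMod 2 := Pi.single d.fst 1 + Pi.single d.snd 1

theorem ends_symm [DecidableEq V] (d : G.Dart) : ends d.symm = ends d := add_comm _ _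

/-- A choice of a direction for every edge of a graph, the edges being labelled by `A`. -/
structure EdgeOrientation {V : Type*} (G : SimpleGraph V) (A : Type*) where
  dart : A → G.Dart
  existsUnique_edge_eq : ∀ d : G.Dart, ∃! a, (dart a).edge = d.edge

namespace EdgeOrientation

variable (o : EdgeOrientation G A)

/-- The label of the edge underlying a dart. -/
noncomputable def arrow (d : G.Dart) : A := (o.existsUnique_edge_eq d).choose

theorem edge_dart_arrow (d : G.Dart) : (o.dart (o.arrow d)).edge = d.edge :=
  (o.existsUnique_edge_eq d).choose_spec.1

theorem arrow_eq {d : G.Dart} {a : A} (h : (o.dart a).edge = d.edge) : o.arrow d = a :=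
  (o.existsUnique_edge_eq d).unique (o.edge_dart_arrow d) h

theorem arrow_dart (a : A) : o.arrow (o.dart a) = a := o.arrow_eq rfl

theorem arrow_symm (d : G.Dart) : o.arrow d.symm = o.arrow d :=
  o.arrow_eq ((o.edge_dart_arrow d).trans d.edge_symm.symm)

theorem eq_or_eq_symm (d : G.Dart) : d = o.dart (o.arrow d) ∨ d = (o.dart (o.arrow d)).symm :=
  SimpleGraph.dart_edge_eq_iff _ _ |>.1 (o.edge_dart_arrow d).symm

theorem ends_dart_arrow [DecidableEq V] (d : G.Dart) : ends (o.dart (o.arrow d)) = ends d := by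
  rcases o.eq_or_eq_symm d with h | h
  · rw [← h]
  · conv_rhs => rw [h, ends_symm]

variable [DecidableEq A]

/-- The chain modulo 2 of a walk. -/
noncomputable def chain {u v : V} (p : G.Walk u v) : A → ZMod 2 :=
  (p.darts.map fun d => Pi.single (o.arrow d) 1).sum

theorem chain_nil (v : V) : o.chain (.nil : G.Walk v v) = 0 := rfl

theorem chain_cons {u v w : V} (h : G.Adj u v) (p : G.Walk v w) :
    o.chain (.cons h p) = Pi.single (o.arrow ⟨(u, v), h⟩) 1 + o.chain p := by
  simp [chain]

theorem chain_append {u v w : V} (p : G.Walk u v) (q : G.Walk v w) :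
    o.chain (p.append q) = o.chain p + o.chain q := by
  simp [chain]

theorem chain_reverse {u v : V} (p : G.Walk u v) : o.chain p.reverse = o.chain p := by
  simp [chain, Function.comp_def, o.arrow_symm, List.sum_reverse]

/-- The space spanned by the closed walks. -/
def cycleSpace : Submodule (ZMod 2) (A → ZMod 2) :=
  Submodule.span (ZMod 2) {x | ∃ (v : V) (p : G.Walk v v), x = o.chain p}

theorem chain_mem_cycleSpace {u v : V} (p : G.Walk u v) (h : u = v) :
    o.chain p ∈ o.cycleSpace := by
  subst h
  exact Submodule.subset_span ⟨u, p, rfl⟩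

variable [DecidableEq V] [Fintype A]

/-- The boundary map modulo 2. -/
def boundary : (A → ZMod 2) →ₗ[ZMod 2] (V → ZMod 2) :=
  Fintype.linearCombination (ZMod 2) fun a => ends (o.dart a)

theorem boundary_single (d : G.Dart) : o.boundary (Pi.single (o.arrow d) 1) = ends d := by
  rw [boundary, Fintype.linearCombination_apply_single, one_smul, ends_dart_arrow]

theorem boundary_chain {u v : V} (p : G.Walk u v) :
    o.boundary (o.chain p) = Pi.single u 1 + Pi.single v 1 := by
  induction p with
  | nil => rw [chain_nil, map_zero, ZModModule.add_self]
  | @cons u v w h p ih =>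
    rw [chain_cons, map_add, ih, boundary_single]
    calc Pi.single u 1 + Pi.single v 1 + (Pi.single v 1 + Pi.single w 1)
      _ = Pi.single u 1 + (Pi.single v 1 + Pi.single v 1) + Pi.single w 1 := by abel
      _ = Pi.single u 1 + Pi.single w 1 := by rw [ZModModule.add_self, add_zero]

theorem cycleSpace_le_ker_boundary : o.cycleSpace ≤ LinearMap.ker o.boundary := by
  rw [cycleSpace, Submodule.span_le]
  rintro _ ⟨v, p, rfl⟩
  rw [SetLike.mem_coe, LinearMap.mem_ker, boundary_chain, ZModModule.add_self]

end EdgeOrientation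

variable (G) in
/-- A walk to `v` from the base point of its connected component. -/
noncomputable def baseWalk (v : V) : G.Walk (G.connectedComponentMk v).out v :=
  (SimpleGraph.ConnectedComponent.exact (Quot.out_eq (G.connectedComponentMk v))).some

variable [Fintype V]

namespace EdgeOrientation

variable (o : EdgeOrientation G A) [DecidableEq A] [DecidableEq V]

/-- The cone construction: a chain with boundary `y`, up to the base points of the connected
components. -/
noncomputable def cone : (V → ZMod 2) →ₗ[ZMod 2] (A → ZMod 2) :=
  Fintype.linearCombination (ZMod 2) fun v => o.chain (baseWalk G v)

theorem cone_single (v : V) : o.cone (Pi.single v 1) = o.chain (baseWalk G v) := by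
  rw [cone, Fintype.linearCombination_apply_single, one_smul]

variable [Fintype A]

theorem add_cone_boundary_mem (x : A → ZMod 2) : x + o.cone (o.boundary x) ∈ o.cycleSpace := by
  suffices h : o.cycleSpace.mkQ ∘ₗ (LinearMap.id + o.cone ∘ₗ o.boundary) = 0 from
    (Submodule.Quotient.mk_eq_zero _).1 (LinearMap.congr_fun h x)
  refine LinearMap.pi_ext' fun a => LinearMap.ext_ring ((Submodule.Quotient.mk_eq_zero _).2 ?_)
  let d := o.dart a
  let p := ((baseWalk G d.fst).append (.cons d.adj .nil)).append (baseWalk G d.snd).reverse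
  have hp : o.chain p = Pi.single a 1 + o.cone (o.boundary (Pi.single a 1)) := by
    nth_rw 2 [← o.arrow_dart a]
    rw [boundary_single, ends, map_add, cone_single, cone_single, chain_append, chain_append,
      chain_reverse, chain_cons, chain_nil, add_zero]
    change _ + Pi.single (o.arrow d) 1 + _ = _
    rw [o.arrow_dart a]
    abel
  have hbase : (G.connectedComponentMk d.fst).out = (G.connectedComponentMk d.snd).out := by
    rw [SimpleGraph.ConnectedComponent.sound d.adj.reachable]
  simpa [hp] using o.chain_mem_cycleSpace p hbase

omit [Fintype V] in
theorem ker_boundary [Finite V] : LinearMap.ker o.boundary = o.cycleSpace := by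
  have := Fintype.ofFinite V
  refine le_antisymm (fun x hx => ?_) o.cycleSpace_le_ker_boundary
  simpa [LinearMap.mem_ker.1 hx] using o.add_cone_boundary_mem x

end EdgeOrientation

variable [DecidableEq G.ConnectedComponent]

variable (G) in
/-- The map that sums a function modulo 2 over each connected component. -/
def componentSum : (V → ZMod 2) →ₗ[ZMod 2] (G.ConnectedComponent → ZMod 2) :=
  Fintype.linearCombination (ZMod 2) fun v => Pi.single (G.connectedComponentMk v) 1

theorem componentSum_single [DecidableEq V] (v : V) :
    componentSum G (Pi.single v 1) = Pi.single (G.connectedComponentMk v) 1 := by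
  rw [componentSum, Fintype.linearCombination_apply_single, one_smul]

theorem componentSum_surjective [Finite G.ConnectedComponent] :
    Function.Surjective (componentSum G) := by
  classical
  rw [← LinearMap.range_eq_top, eq_top_iff, ← (Pi.basisFun (ZMod 2) _).span_eq, Submodule.span_le]
  rintro _ ⟨c, rfl⟩
  induction c using SimpleGraph.ConnectedComponent.ind with | _ v
  exact ⟨Pi.single v 1, by rw [componentSum_single, Pi.basisFun_apply]⟩

namespace EdgeOrientation

variable (o : EdgeOrientation G A) [DecidableEq A] [DecidableEq V] [Fintype A]

theorem boundary_cone {y : V → ZMod 2} (hy : componentSum G y = 0) : o.boundary (o.cone y) = y := by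
  have := Fintype.ofFinite G.ConnectedComponent
  let base : (G.ConnectedComponent → ZMod 2) →ₗ[ZMod 2] (V → ZMod 2) :=
    Fintype.linearCombination (ZMod 2) fun c => Pi.single c.out 1
  have hcone : o.boundary ∘ₗ o.cone = base ∘ₗ componentSum G + LinearMap.id := by
    refine LinearMap.pi_ext' fun v => LinearMap.ext_ring ?_
    simp only [LinearMap.comp_apply, LinearMap.add_apply, LinearMap.id_apply,
      LinearMap.coe_single, cone_single, boundary_chain, componentSum_single, base,
      Fintype.linearCombination_apply_single, one_smul]
  simpa [hy] using LinearMap.congr_fun hcone y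

omit [DecidableEq A] in
theorem range_boundary : LinearMap.range o.boundary = LinearMap.ker (componentSum G) := by
  classical
  refine le_antisymm ?_ fun y hy => ⟨o.cone y, o.boundary_cone hy⟩
  rw [boundary, Fintype.range_linearCombination, Submodule.span_le]
  rintro _ ⟨a, rfl⟩
  change componentSum G (Pi.single _ 1 + Pi.single _ 1) = 0
  rw [map_add, componentSum_single, componentSum_single,
    SimpleGraph.ConnectedComponent.sound (o.dart a).adj.reachable, ZModModule.add_self]

omit [DecidableEq V] [DecidableEq G.ConnectedComponent] in
theorem finrank_cycleSpace : Module.finrank (ZMod 2) o.cycleSpace + Fintype.card V =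
    Fintype.card A + Nat.card G.ConnectedComponent := by
  classical
  have := Fintype.ofFinite G.ConnectedComponent
  have hboundary := LinearMap.finrank_range_add_finrank_ker o.boundary
  have hsum := LinearMap.finrank_range_add_finrank_ker (componentSum G)
  rw [LinearMap.range_eq_top.2 componentSum_surjective, finrank_top,
    Module.finrank_fintype_fun_eq_card, Module.finrank_fintype_fun_eq_card] at hsum
  rw [range_boundary, ker_boundary, Module.finrank_fintype_fun_eq_card] at hboundary
  rw [Nat.card_eq_fintype_card]
  omega

end EdgeOrientation

end CycleSpace

/-! ## The group `M_G` modulo signs -/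

section Presentation

variable {V : Type} {G : SimpleGraph V}

namespace MG

theorem mk_eq_of_relator {x y : FreeGroup (Generator G)} (h : Relator G (x * y⁻¹)) :
    (PresentedGroup.mk _ x : MG G) = PresentedGroup.mk _ y :=
  PresentedGroup.mk_eq_mk_of_mul_inv_mem h

theorem phase_mul_phase (a b : ZMod 4) :
    gen G (.phase a) * gen G (.phase b) = gen G (.phase (a + b)) :=
  mk_eq_of_relator (.phase_mul a b)

theorem phase_zero : gen G (.phase 0) = 1 := by
  simpa using phase_mul_phase (G := G) 0 0

theorem phase_mul_comm (a : ZMod 4) (g : Generator G) :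
    gen G (.phase a) * gen G g = gen G g * gen G (.phase a) :=
  mk_eq_of_relator (.phase_central a g)

theorem edge_mul_self (d : G.Dart) : gen G (.edge d) * gen G (.edge d) = 1 :=
  PresentedGroup.one_of_mem (Relator.edge_sq d)

theorem vertex_mul_self (v : V) : gen G (.vertex v) * gen G (.vertex v) = 1 :=
  PresentedGroup.one_of_mem (Relator.vertex_sq v)

theorem edge_eq_neg_symm (d : G.Dart) :
    gen G (.edge d) = gen G (.phase 2) * gen G (.edge d.symm) :=
  mk_eq_of_relator (.edge_symm d)

theorem edge_mul_vertex_comm (d : G.Dart) {k : V} (h₁ : k ≠ d.fst) (h₂ : k ≠ d.snd) :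
    gen G (.edge d) * gen G (.vertex k) = gen G (.vertex k) * gen G (.edge d) :=
  mk_eq_of_relator (.edge_vertex d k h₁ h₂)

theorem edge_mul_vertex_anticomm (d : G.Dart) : gen G (.edge d) * gen G (.vertex d.snd) =
    gen G (.phase 2) * gen G (.vertex d.snd) * gen G (.edge d) :=
  mk_eq_of_relator (.edge_vertex_anti d)

theorem closure_range_gen : Subgroup.closure (Set.range (gen G)) = ⊤ :=
  PresentedGroup.closure_range_of _

theorem phase_mem_center (a : ZMod 4) : gen G (.phase a) ∈ Subgroup.center (MG G) := by
  have h : (⊤ : Subgroup (MG G)) ≤ Subgroup.centralizer {gen G (.phase a)} := by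
    rw [← closure_range_gen, Subgroup.closure_le]
    rintro _ ⟨g, rfl⟩
    exact Subgroup.mem_centralizer_singleton_iff.2 (phase_mul_comm a g).symm
  exact Subgroup.mem_center_iff.2 fun g =>
    Subgroup.mem_centralizer_singleton_iff.1 (h (Subgroup.mem_top g))

end MG

open MG

variable (G) in
/-- The subgroup `{±1}` of `M_G`. -/
def signs : Subgroup (MG G) := Subgroup.zpowers (gen G (.phase 2))

theorem mem_signs {m : MG G} (hm : m ∈ signs G) : m = 1 ∨ m = gen G (.phase 2) := by
  obtain ⟨n, rfl⟩ := Subgroup.mem_zpowers_iff.1 hm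
  have hsq : gen G (.phase 2) ^ (2 : ℤ) = 1 := by
    rw [zpow_ofNat, pow_two, phase_mul_phase]
    exact phase_zero
  obtain ⟨k, rfl | rfl⟩ := Int.even_or_odd' n
  · left; rw [zpow_mul, hsq, one_zpow]
  · right; rw [zpow_add, zpow_mul, hsq, one_zpow, one_mul, zpow_one]

instance : (signs G).Normal :=
  ⟨fun m hm g => by
    have hcenter : m ∈ Subgroup.center (MG G) :=
      Subgroup.zpowers_le.2 (phase_mem_center 2) hm
    rwa [Subgroup.mem_center_iff.1 hcenter g, mul_inv_cancel_right]⟩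

/-- The group `M_G / {±1}`, a vector space over `ℤ/2`. -/
abbrev UnsignedMG (G : SimpleGraph V) : Type := MG G ⧸ signs G

theorem mk_phase_two : (gen G (.phase 2) : UnsignedMG G) = 1 :=
  (QuotientGroup.eq_one_iff _).2 (Subgroup.mem_zpowers _)

theorem mk_edge_symm (d : G.Dart) :
    (gen G (.edge d.symm) : UnsignedMG G) = gen G (.edge d) := by
  rw [edge_eq_neg_symm d, QuotientGroup.mk_mul, mk_phase_two, one_mul]

theorem commute_mk {x y : MG G} (h : x * y = y * x ∨ x * y = gen G (.phase 2) * y * x) :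
    Commute (x : UnsignedMG G) (y : UnsignedMG G) := by
  obtain h | h := h
  · exact congrArg QuotientGroup.mk h
  · have h' := congrArg (QuotientGroup.mk : _ → UnsignedMG G) h
    rwa [QuotientGroup.mk_mul, QuotientGroup.mk_mul, QuotientGroup.mk_mul, mk_phase_two,
      one_mul] at h'

theorem commute_mk_edge_vertex (d : G.Dart) (k : V) :
    Commute (gen G (.edge d) : UnsignedMG G) (gen G (.vertex k) : UnsignedMG G) := by
  by_cases h₁ : k = d.fst
  · rw [← mk_edge_symm, h₁]
    exact commute_mk (.inr (edge_mul_vertex_anticomm d.symm))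
  by_cases h₂ : k = d.snd
  · rw [h₂]
    exact commute_mk (.inr (edge_mul_vertex_anticomm d))
  · exact commute_mk (.inl (edge_mul_vertex_comm d h₁ h₂))

theorem commute_mk_edge_edge_of_snd_eq_fst {d d' : G.Dart} (h : d.snd = d'.fst) :
    Commute (gen G (.edge d) : UnsignedMG G) (gen G (.edge d') : UnsignedMG G) := by
  by_cases h' : d.fst = d'.snd
  · rw [← mk_edge_symm, show d.symm = d' from SimpleGraph.Dart.ext _ _ (Prod.ext h h')]
  · exact commute_mk (.inr (mk_eq_of_relator (.edge_edge_anti d d' h h')))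

theorem commute_mk_edge_edge (d d' : G.Dart) :
    Commute (gen G (.edge d) : UnsignedMG G) (gen G (.edge d') : UnsignedMG G) := by
  by_cases h₁ : d.fst = d'.fst
  · rw [← mk_edge_symm d]
    exact commute_mk_edge_edge_of_snd_eq_fst h₁
  by_cases h₂ : d.fst = d'.snd
  · exact (commute_mk_edge_edge_of_snd_eq_fst h₂.symm).symm
  by_cases h₃ : d.snd = d'.fst
  · exact commute_mk_edge_edge_of_snd_eq_fst h₃
  by_cases h₄ : d.snd = d'.snd
  · rw [← mk_edge_symm d']
    exact commute_mk_edge_edge_of_snd_eq_fst h₄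
  · exact commute_mk (.inl (mk_eq_of_relator (.edge_edge d d' h₁ h₂ h₃ h₄)))

theorem commute_mk_gen (g g' : Generator G) :
    Commute (gen G g : UnsignedMG G) (gen G g' : UnsignedMG G) := by
  rcases g with i | d | a <;> rcases g' with j | d' | b
  · exact commute_mk (.inl (mk_eq_of_relator (.vertex_vertex i j)))
  · exact (commute_mk_edge_vertex d' i).symm
  · exact (commute_mk (.inl (phase_mul_comm b _))).symm
  · exact commute_mk_edge_vertex d j
  · exact commute_mk_edge_edge d d'
  · exact (commute_mk (.inl (phase_mul_comm b _))).symm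
  all_goals exact commute_mk (.inl (phase_mul_comm a _))

variable (G) in
theorem closure_range_mk_gen :
    Subgroup.closure (Set.range fun g => (gen G g : UnsignedMG G)) = ⊤ := by
  have hrange : Set.range (fun g => (gen G g : UnsignedMG G)) =
      QuotientGroup.mk' (signs G) '' Set.range (gen G) :=
    Set.range_comp (QuotientGroup.mk' (signs G)) (gen G)
  rw [hrange, ← MonoidHom.map_closure, closure_range_gen]
  exact Subgroup.map_top_of_surjective _ (QuotientGroup.mk'_surjective _)

theorem unsignedMG_mul_comm (a b : UnsignedMG G) : a * b = b * a := by
  have := Subgroup.isMulCommutative_closure (k := Set.range fun g => (gen G g : UnsignedMG G))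
    (by rintro _ ⟨g, rfl⟩ _ ⟨g', rfl⟩; exact commute_mk_gen g g')
  have hmem := fun x : UnsignedMG G => closure_range_mk_gen G ▸ Subgroup.mem_top x
  exact setLike_mul_comm (hmem a) (hmem b)

noncomputable instance : CommGroup (UnsignedMG G) :=
  { QuotientGroup.Quotient.group (signs G) with mul_comm := unsignedMG_mul_comm }

theorem unsignedMG_sq (a : UnsignedMG G) : a ^ 2 = 1 := by
  have hgen : Set.range (fun g => (gen G g : UnsignedMG G)) ⊆
      (powMonoidHom (α := UnsignedMG G) 2).ker := by
    rintro _ ⟨v | d | c, rfl⟩ <;>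
      rw [SetLike.mem_coe, MonoidHom.mem_ker, powMonoidHom_apply, pow_two, ← QuotientGroup.mk_mul]
    · rw [vertex_mul_self, QuotientGroup.mk_one]
    · rw [edge_mul_self, QuotientGroup.mk_one]
    · rw [phase_mul_phase]
      obtain h | h := (by decide : ∀ c : ZMod 4, c + c = 0 ∨ c + c = 2) c
      · rw [h, phase_zero, QuotientGroup.mk_one]
      · rw [h, mk_phase_two]
  have hle := (Subgroup.closure_le _).2 hgen
  rw [closure_range_mk_gen] at hle
  exact hle (Subgroup.mem_top a)

noncomputable instance : Module (ZMod 2) (Additive (UnsignedMG G)) :=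
  AddCommGroup.zmodModule fun a => unsignedMG_sq a.toMul

variable (G) in
/-- The class of an element of `M_G` up to sign, as a vector over `ℤ/2`. -/
noncomputable def unsign : MG G →* Multiplicative (Additive (UnsignedMG G)) where
  toFun m := .ofAdd (.ofMul (m : UnsignedMG G))
  map_one' := rfl
  map_mul' _ _ := rfl

theorem unsign_eq_unsign_iff {x y : MG G} : unsign G x = unsign G y ↔ x⁻¹ * y ∈ signs G :=
  QuotientGroup.eq (s := signs G)

theorem unsign_edge_symm (d : G.Dart) :
    unsign G (gen G (.edge d.symm)) = unsign G (gen G (.edge d)) := mk_edge_symm d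

variable {Q : Type} [Fintype Q]

open PauliGroup in
theorem exists_representation [DecidableEq V] (v : V → PauliGroup Q) (e : G.Dart → PauliGroup Q)
    (hv : ∀ i, v i * v i = 1) (he : ∀ d, e d * e d = 1)
    (hsymm : ∀ d, e d = scalar Q 2 * e d.symm) (hvv : ∀ i j, form (v i) (v j) = 0)
    (hev : ∀ (d : G.Dart) k, form (e d) (v k) = ends d k)
    (hee : ∀ d d' : G.Dart, form (e d) (e d') = ends d' d.fst + ends d' d.snd) :
    ∃ σ : MG G →* PauliGroup Q, (∀ a, σ (gen G (.phase a)) = scalar Q a) ∧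
      (∀ i, σ (gen G (.vertex i)) = v i) ∧ ∀ d, σ (gen G (.edge d)) = e d := by
  let f : Generator G → PauliGroup Q
    | .vertex i => v i
    | .edge d => e d
    | .phase a => scalar Q a
  have hf : ∀ r ∈ {w | Relator G w}, FreeGroup.lift f r = 1 := by
    rintro r (⟨a, b⟩ | ⟨a, g⟩ | d | i | d | ⟨i, j⟩ | ⟨d, k, h₁, h₂⟩ | ⟨d, d', h₁, h₂, h₃, h₄⟩ | d |
      ⟨d, d', h₁, h₂⟩) <;>
      simp only [map_mul, map_inv, FreeGroup.lift_apply_of, mul_inv_eq_one]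
    · exact scalar_mul_scalar a b
    · exact scalar_comm a _
    · exact he d
    · exact hv i
    · exact hsymm d
    · exact commute_of_form_eq_zero (hvv i j)
    · exact commute_of_form_eq_zero ((hev d k).trans (by simp [ends, h₁, h₂]))
    · exact commute_of_form_eq_zero ((hee d d').trans (by simp [ends, h₁, h₂, h₃, h₄]))
    · exact anticommute_of_form_eq_one ((hev d d.snd).trans (by simp [ends, d.snd_ne_fst]))
    · have h₃ : d.fst ≠ d'.fst := h₁ ▸ d.fst_ne_snd
      exact anticommute_of_form_eq_one
        ((hee d d').trans (by simp [ends, h₁, h₂.symm, h₃, d'.fst_ne_snd]))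
  exact ⟨PresentedGroup.toGroup hf, fun _ => PresentedGroup.toGroup.of hf,
    fun _ => PresentedGroup.toGroup.of hf, fun _ => PresentedGroup.toGroup.of hf⟩

open PauliGroup in
theorem EdgeOrientation.exists_representation {A : Type*} (o : EdgeOrientation G A) [DecidableEq V]
    (v : V → PauliGroup Q) (e : A → PauliGroup Q) (hv : ∀ i, v i * v i = 1)
    (he : ∀ a, e a * e a = 1) (hvv : ∀ i j, form (v i) (v j) = 0)
    (hev : ∀ a k, form (e a) (v k) = ends (o.dart a) k)
    (hee : ∀ a b,
      form (e a) (e b) = ends (o.dart b) (o.dart a).fst + ends (o.dart b) (o.dart a).snd) :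
    ∃ σ : MG G →* PauliGroup Q, (∀ a, σ (gen G (.phase a)) = scalar Q a) ∧
      (∀ i, σ (gen G (.vertex i)) = v i) ∧ ∀ a, σ (gen G (.edge (o.dart a))) = e a := by
  classical
  let s (d : G.Dart) : ZMod 4 := if d = o.dart (o.arrow d) then 0 else 2
  have hs (d : G.Dart) : s d = 2 + s d.symm := by
    dsimp only [s]
    rw [o.arrow_symm]
    rcases o.eq_or_eq_symm d with h | h
    · rw [if_pos h, if_neg fun h' => d.symm_ne (h'.trans h.symm)]
      rfl
    · rw [if_neg fun h' => (o.dart _).symm_ne (h.symm.trans h'), if_pos (by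
        conv_lhs => rw [h, SimpleGraph.Dart.symm_symm])]
      rfl
  have hsq (d : G.Dart) :
      scalar Q (s d) * e (o.arrow d) * (scalar Q (s d) * e (o.arrow d)) = 1 := by
    rw [mul_assoc, ← mul_assoc (e _), ← scalar_comm, mul_assoc, he, mul_one, scalar_mul_scalar]
    dsimp only [s]
    split_ifs <;> rfl
  have hsymm (d : G.Dart) : scalar Q (s d) * e (o.arrow d) =
      scalar Q 2 * (scalar Q (s d.symm) * e (o.arrow d.symm)) := by
    rw [o.arrow_symm, ← mul_assoc, scalar_mul_scalar, ← hs]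
  have hform (d d' : G.Dart) :
      form (scalar Q (s d) * e (o.arrow d)) (scalar Q (s d') * e (o.arrow d')) =
        ends d' d.fst + ends d' d.snd := by
    rw [form_scalar_mul_left, form_scalar_mul_right, hee, ends_dart_arrow]
    rcases o.eq_or_eq_symm d with h | h
    · rw [← h]
    · conv_rhs => rw [h, add_comm]
      rfl
  obtain ⟨σ, hphase, hvertex, hedge⟩ := FermionEncoding.exists_representation v
    (fun d => scalar Q (s d) * e (o.arrow d)) hv hsq hsymm hvv
    (fun d k => by rw [form_scalar_mul_left, hev, ends_dart_arrow]) hform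
  refine ⟨σ, hphase, hvertex, fun a => (hedge _).trans ?_⟩
  rw [o.arrow_dart, show s (o.dart a) = 0 from if_pos (by rw [o.arrow_dart])]
  exact one_mul _

end Presentation

section Chains

variable {V : Type} {G : SimpleGraph V}

open MG PauliGroup

/-- The element `i ^ n e_{i_1 i_2} e_{i_2 i_3} ⋯ e_{i_n i_{n + 1}}` of `M_G` attached to a walk with
`n` edges, closed or not. -/
def walkElement {u v : V} (p : G.Walk u v) : MG G :=
  gen G (.phase (p.length : ZMod 4)) * (p.darts.map fun d => gen G (.edge d)).prod

theorem walkElement_nil (v : V) : walkElement (.nil : G.Walk v v) = 1 := by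
  simp [walkElement, phase_zero]

theorem walkElement_cons {u v w : V} (h : G.Adj u v) (p : G.Walk v w) :
    walkElement (.cons h p) =
      gen G (.phase 1) * gen G (.edge ⟨(u, v), h⟩) * walkElement p := by
  simp only [walkElement, SimpleGraph.Walk.length_cons, SimpleGraph.Walk.darts_cons,
    List.map_cons, List.prod_cons, Nat.cast_add, Nat.cast_one, add_comm _ (1 : ZMod 4),
    ← phase_mul_phase, mul_assoc]
  rw [← mul_assoc (gen G (.edge _)), ← phase_mul_comm, mul_assoc]

variable {A : Type*} [DecidableEq A] [Fintype A]

namespace EdgeOrientation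

variable (o : EdgeOrientation G A)

/-- The class up to sign of the product of `i e` over the oriented edges `e` of a chain. -/
noncomputable def chainClass : (A → ZMod 2) →ₗ[ZMod 2] Additive (UnsignedMG G) :=
  Fintype.linearCombination (ZMod 2) fun a =>
    (unsign G (gen G (.phase 1) * gen G (.edge (o.dart a)))).toAdd

theorem chainClass_single (d : G.Dart) : o.chainClass (Pi.single (o.arrow d) 1) =
    (unsign G (gen G (.phase 1) * gen G (.edge d))).toAdd := by
  rw [chainClass, Fintype.linearCombination_apply_single, one_smul, map_mul (unsign G),
    map_mul (unsign G)]
  rcases o.eq_or_eq_symm d with h | h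
  · rw [← h]
  · conv_rhs => rw [h, unsign_edge_symm]

theorem unsign_walkElement {u v : V} (p : G.Walk u v) :
    (unsign G (walkElement p)).toAdd = o.chainClass (o.chain p) := by
  induction p with
  | nil => rw [walkElement_nil, chain_nil, map_one, map_zero, toAdd_one]
  | cons h p ih => rw [walkElement_cons, chain_cons, map_mul, map_add, toAdd_mul, ih,
      chainClass_single]

variable {Q : Type} [Fintype Q] (σ : MG G →* PauliGroup Q)

/-- The bits of the product of the edge operators of a chain. -/
noncomputable def bitsMap : (A → ZMod 2) →ₗ[ZMod 2] (Q → ZMod 2 × ZMod 2) :=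
  Fintype.linearCombination (ZMod 2) fun a => (σ (gen G (.edge (o.dart a)))).bits.toAdd

end EdgeOrientation

variable {Q : Type} [Fintype Q] {σ : MG G →* PauliGroup Q}

theorem map_edge_eq_neg_symm (hσ : ∀ a, σ (gen G (.phase a)) = scalar Q a) (d : G.Dart) :
    σ (gen G (.edge d)) = scalar Q 2 * σ (gen G (.edge d.symm)) := by
  rw [edge_eq_neg_symm d, map_mul, hσ]

theorem form_map_edge_vertex [DecidableEq V] (hσ : ∀ a, σ (gen G (.phase a)) = scalar Q a)
    (d : G.Dart) (k : V) :
    form (σ (gen G (.edge d))) (σ (gen G (.vertex k))) = ends d k := by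
  have hsnd : ∀ d : G.Dart, form (σ (gen G (.edge d))) (σ (gen G (.vertex d.snd))) = 1 :=
    fun d => form_eq_of_mul_eq (by
      rw [← map_mul, edge_mul_vertex_anticomm, map_mul, map_mul, hσ, mul_assoc]
      rfl)
  by_cases h₁ : k = d.fst
  · rw [h₁, map_edge_eq_neg_symm hσ, form_scalar_mul_left]
    exact (hsnd d.symm).trans (by simp [ends, d.fst_ne_snd])
  by_cases h₂ : k = d.snd
  · rw [h₂, hsnd]
    simp [ends, d.snd_ne_fst]
  · rw [form_eq_of_mul_eq (r := 0)]
    · simp [ends, h₁, h₂]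
    · rw [← map_mul, edge_mul_vertex_comm d h₁ h₂, map_mul]
      exact (one_mul _).symm

namespace EdgeOrientation

variable (o : EdgeOrientation G A)

theorem bitsMap_single (hσ : ∀ a, σ (gen G (.phase a)) = scalar Q a) (d : G.Dart) :
    o.bitsMap σ (Pi.single (o.arrow d) 1) = (σ (gen G (.edge d))).bits.toAdd := by
  rw [bitsMap, Fintype.linearCombination_apply_single, one_smul]
  rcases o.eq_or_eq_symm d with h | h
  · rw [← h]
  · conv_rhs => rw [h, map_edge_eq_neg_symm hσ, SimpleGraph.Dart.symm_symm, map_mul]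
    exact (zero_add _).symm

theorem bits_map_walkElement (hσ : ∀ a, σ (gen G (.phase a)) = scalar Q a) {u v : V}
    (p : G.Walk u v) :
    (σ (walkElement p)).bits.toAdd = o.bitsMap σ (o.chain p) := by
  induction p with
  | nil => rw [walkElement_nil, chain_nil, map_one, map_one, map_zero, toAdd_one]
  | cons h p ih =>
    rw [walkElement_cons, chain_cons, map_mul σ, map_mul σ, map_mul bits, map_mul bits, map_add,
      toAdd_mul, toAdd_mul, ih, bitsMap_single o hσ, hσ]
    exact congrArg (· + _) (zero_add _)

omit [DecidableEq A] in
theorem ker_bitsMap_le (hσ : ∀ a, σ (gen G (.phase a)) = scalar Q a) [DecidableEq V] :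
    LinearMap.ker (o.bitsMap σ) ≤ LinearMap.ker o.boundary := by
  classical
  have h (k : V) : (pairing (σ (gen G (.vertex k)))) ∘ₗ o.bitsMap σ =
      LinearMap.proj k ∘ₗ o.boundary := by
    refine LinearMap.pi_ext' fun a => LinearMap.ext_ring ?_
    simp only [LinearMap.comp_apply, LinearMap.single_apply, LinearMap.proj_apply]
    rw [← o.arrow_dart a, bitsMap_single o hσ, pairing_bits, boundary_single,
      form_map_edge_vertex hσ]
  intro x hx
  refine LinearMap.mem_ker.2 (funext fun k => ?_)
  have hk := LinearMap.congr_fun (h k) x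
  rw [LinearMap.comp_apply, LinearMap.mem_ker.1 hx, map_zero] at hk
  exact hk.symm

end EdgeOrientation

end Chains

/-! ## The Jordan–Wigner representation -/

section JordanWigner

variable {V : Type} [LinearOrder V]

open PauliGroup

/-- The Jordan–Wigner representation `Z_1 ⋯ Z_{j - 1} X_j` of the Majorana operators. -/
def majorana (j : V) : PauliGroup V :=
  ⟨0, fun k => if k = j then .X else if k < j then .Z else .I⟩

/-- The Pauli operator `Z_j`, the parity of the `j`-th mode. -/
def parity (j : V) : PauliGroup V := ⟨0, fun k => if k = j then .Z else .I⟩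

theorem xBit_majorana (j k : V) : ((majorana j).op k).xBit = if k = j then 1 else 0 := by
  dsimp only [majorana]
  split_ifs <;> rfl

theorem zBit_majorana (j k : V) : ((majorana j).op k).zBit = if k < j then 1 else 0 := by
  dsimp only [majorana]
  split_ifs with h h'
  · exact absurd h' h.not_lt
  all_goals rfl

variable [Fintype V]

theorem majorana_mul_self (j : V) : majorana j * majorana j = 1 := mul_eq_scalar_of_op_eq rfl

theorem parity_mul_self (j : V) : parity j * parity j = 1 := mul_eq_scalar_of_op_eq rfl

theorem form_parity_parity (i j : V) : form (parity i) (parity j) = 0 := by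
  refine Finset.sum_eq_zero fun k _ => ?_
  dsimp only [parity]
  split_ifs <;> rfl

theorem form_majorana_parity (j k : V) :
    form (majorana j) (parity k) = (Pi.single j 1 : V → ZMod 2) k := by
  have hx (l : V) : ((parity k).op l).xBit = 0 := by dsimp only [parity]; split_ifs <;> rfl
  have hz (l : V) : ((parity k).op l).zBit = if l = k then 1 else 0 := by
    dsimp only [parity]; split_ifs <;> rfl
  simp [form, Pauli.form, xBit_majorana, hx, hz, Pi.single_apply]

theorem form_majorana_majorana (i j : V) :
    form (majorana i) (majorana j) = 1 + (Pi.single j 1 : V → ZMod 2) i := by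
  have hsum (i j : V) : ∑ k, (if k = i then 1 else 0) * (if k < j then 1 else 0) =
      if i < j then (1 : ZMod 2) else 0 := by
    simp only [ite_mul, one_mul, zero_mul, Finset.sum_ite_eq', Finset.mem_univ, if_true]
  simp only [form, Pauli.form, xBit_majorana, zBit_majorana, Finset.sum_add_distrib, hsum,
    mul_comm (ite (_ < i) _ _), Pi.single_apply]
  rcases lt_trichotomy i j with h | rfl | h
  · simp [h, h.not_gt, h.ne]
  · simp [CharTwo.add_self_eq_zero]
  · simp [h, h.not_gt, h.ne']

theorem majorana_anticomm {i j : V} (h : i ≠ j) :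
    majorana i * majorana j = scalar V 2 * (majorana j * majorana i) := by
  rw [← mul_assoc]
  exact anticommute_of_form_eq_one (by simp [form_majorana_majorana, h])

theorem majorana_mul_mul_self {i j : V} (h : i ≠ j) :
    majorana i * majorana j * (majorana i * majorana j) = scalar V 2 := by
  nth_rewrite 1 [majorana_anticomm h]
  rw [mul_assoc, mul_assoc (majorana j), ← mul_assoc (majorana i), majorana_mul_self, one_mul,
    majorana_mul_self, mul_one]

variable {G : SimpleGraph V}

/-- The edge operator `-i c_j c_k` of a pair of Majorana operators. -/
def majoranaEdge (d : G.Dart) : PauliGroup V :=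
  scalar V 3 * (majorana d.fst * majorana d.snd)

theorem majoranaEdge_eq_neg_symm (d : G.Dart) :
    majoranaEdge d = scalar V 2 * majoranaEdge d.symm := by
  rw [majoranaEdge, majorana_anticomm d.fst_ne_snd, ← mul_assoc, scalar_comm, mul_assoc]
  rfl

theorem majoranaEdge_mul_self (d : G.Dart) : majoranaEdge d * majoranaEdge d = 1 := by
  rw [majoranaEdge, mul_assoc, ← mul_assoc _ (scalar V 3), ← scalar_comm, mul_assoc (scalar V 3),
    majorana_mul_mul_self d.fst_ne_snd, scalar_mul_scalar, scalar_mul_scalar]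
  rfl

theorem form_majoranaEdge_parity (d : G.Dart) (k : V) :
    form (majoranaEdge d) (parity k) = ends d k := by
  rw [majoranaEdge, form_scalar_mul_left, form_mul_left, form_majorana_parity,
    form_majorana_parity]
  rfl

theorem form_majoranaEdge_majoranaEdge (d d' : G.Dart) :
    form (majoranaEdge d) (majoranaEdge d') = ends d' d.fst + ends d' d.snd := by
  rw [majoranaEdge, majoranaEdge, form_scalar_mul_left, form_scalar_mul_right]
  simp only [form_mul_left, form_mul_right, form_majorana_majorana, ends, Pi.add_apply]
  linear_combination 2 * (CharTwo.two_eq_zero : (2 : ZMod 2) = 0)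

variable (G) in
theorem exists_fermionic_representation : ∃ τ : MG G →* PauliGroup V,
    (∀ a, τ (MG.gen G (.phase a)) = scalar V a) ∧
      ∀ d, τ (MG.gen G (.edge d)) = majoranaEdge d := by
  obtain ⟨τ, hphase, -, hedge⟩ := exists_representation (G := G) parity majoranaEdge
    parity_mul_self majoranaEdge_mul_self majoranaEdge_eq_neg_symm form_parity_parity
    form_majoranaEdge_parity form_majoranaEdge_majoranaEdge
  exact ⟨τ, hphase, hedge⟩

theorem map_walkElement_of_map_edge_eq_majoranaEdge {τ : MG G →* PauliGroup V}
    (hphase : ∀ a, τ (MG.gen G (.phase a)) = scalar V a)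
    (hedge : ∀ d, τ (MG.gen G (.edge d)) = majoranaEdge d) {u v : V} (p : G.Walk u v) :
    τ (walkElement p) = majorana u * majorana v := by
  induction p with
  | nil => rw [walkElement_nil, map_one, majorana_mul_self]
  | @cons u v w h p ih =>
    have hedge' : scalar V 1 * majoranaEdge (⟨(u, v), h⟩ : G.Dart) = majorana u * majorana v := by
      rw [majoranaEdge, ← mul_assoc, scalar_mul_scalar]
      exact one_mul _
    rw [walkElement_cons, map_mul, map_mul, hphase, hedge, hedge', ih, mul_assoc,
      ← mul_assoc (majorana v), majorana_mul_self, one_mul]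

end JordanWigner

/-! ## The stabilizer group -/

section Encodings

variable {V : Type} {G : SimpleGraph V}

open PauliGroup

variable (G) in
theorem disjoint_cycleGroup_signs [Finite V] : Disjoint (cycleGroup G) (signs G) := by
  have := Fintype.ofFinite V
  let := LinearOrder.lift' (Fintype.equivFin V) (Fintype.equivFin V).injective
  obtain ⟨τ, hphase, hedge⟩ := exists_fermionic_representation G
  have hker : cycleGroup G ≤ τ.ker := (Subgroup.closure_le _).2 <| by
    rintro _ ⟨v, p, rfl⟩
    exact (map_walkElement_of_map_edge_eq_majoranaEdge hphase hedge p).trans (majorana_mul_self v)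
  refine Subgroup.disjoint_def.2 fun {m} hm hsign => (mem_signs hsign).resolve_right ?_
  rintro rfl
  have h := (hphase 2).symm.trans (hker hm)
  exact absurd (congrArg phase h) (by decide : (2 : ZMod 4) ≠ 0)

variable {Q : Type} [Fintype Q] {σ : MG G →* PauliGroup Q}

theorem IsEncoding.injOn_bits (hσ : IsEncoding σ) :
    Set.InjOn bits (stabilizerGroup σ : Set (PauliGroup Q)) := by
  intro x hx y hy hxy
  have hbits : (x⁻¹ * y).bits = 1 := by rw [map_mul, map_inv, hxy, inv_mul_cancel]
  have hmem : x⁻¹ * y ∈ stabilizerGroup σ := mul_mem (inv_mem hx) hy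
  rw [eq_scalar_of_bits hbits] at hmem
  have hsq := mul_mem hmem hmem
  rw [scalar_mul_scalar] at hsq
  rw [← inv_mul_eq_one, eq_scalar_of_bits hbits]
  obtain h | h | h := (by decide : ∀ c : ZMod 4, c = 0 ∨ c = 2 ∨ c + c = 2) (x⁻¹ * y).phase
  · rw [h]; rfl
  · exact absurd (h ▸ hmem) hσ.neg_one_notMem
  · exact absurd (h ▸ hsq) hσ.neg_one_notMem

variable {A : Type*} [DecidableEq A] [Fintype A] (o : EdgeOrientation G A)

theorem stabilizerGroup_eq_closure (σ : MG G →* PauliGroup Q) : stabilizerGroup σ =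
    Subgroup.closure (σ '' {c | ∃ (v : V) (p : G.Walk v v), c = cycleElement G p}) :=
  MonoidHom.map_closure σ _

theorem IsEncoding.rank_stabilizerGroup (hσ : IsEncoding σ) :
    Group.rank (stabilizerGroup σ) =
      Module.finrank (ZMod 2) (o.cycleSpace.map (o.bitsMap σ)) := by
  have himage : o.bitsMap σ '' {x | ∃ (v : V) (p : G.Walk v v), x = o.chain p} =
      (fun g => (bits g).toAdd) ''
        (σ '' {c | ∃ (v : V) (p : G.Walk v v), c = cycleElement G p}) := by
    ext y
    constructor
    · rintro ⟨_, ⟨v, p, rfl⟩, rfl⟩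
      exact ⟨_, ⟨_, ⟨v, p, rfl⟩, rfl⟩, o.bits_map_walkElement hσ.phase p⟩
    · rintro ⟨_, ⟨_, ⟨v, p, rfl⟩, rfl⟩, rfl⟩
      exact ⟨_, ⟨v, p, rfl⟩, (o.bits_map_walkElement hσ.phase p).symm⟩
  have hinj := hσ.injOn_bits
  rw [stabilizerGroup_eq_closure] at hinj
  rw [EdgeOrientation.cycleSpace, Submodule.map_span, himage,
    ← rank_closure_eq_finrank_span bits hinj,
    Group.rank_congr (MulEquiv.subgroupCongr (stabilizerGroup_eq_closure σ))]

omit [DecidableEq A] in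
theorem IsEncoding.rank_stabilizerGroup_add [Fintype V] (hσ : IsEncoding σ) :
    Group.rank (stabilizerGroup σ) + Module.finrank (ZMod 2) (LinearMap.ker (o.bitsMap σ)) +
      Fintype.card V = Fintype.card A + Nat.card G.ConnectedComponent := by
  classical
  rw [hσ.rank_stabilizerGroup o, finrank_map_add_finrank_ker _
    (o.ker_boundary ▸ o.ker_bitsMap_le hσ.phase), o.finrank_cycleSpace]

omit [DecidableEq A] in
theorem exists_chain_of_mem_cycleGroup (hphase : ∀ a, σ (MG.gen G (.phase a)) = scalar Q a)
    {c : MG G} (hc : c ∈ cycleGroup G) : ∃ x,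
      o.chainClass x = (unsign G c).toAdd ∧ o.bitsMap σ x = (σ c).bits.toAdd := by
  classical
  induction hc using Subgroup.closure_induction with
  | mem c hc =>
    obtain ⟨v, p, rfl⟩ := hc
    exact ⟨o.chain p, (o.unsign_walkElement p).symm, (o.bits_map_walkElement hphase p).symm⟩
  | one => exact ⟨0, by simp, by simp⟩
  | mul c d _ _ hc hd =>
    obtain ⟨x, hx, hx'⟩ := hc
    obtain ⟨y, hy, hy'⟩ := hd
    exact ⟨x + y, by simp [hx, hy], by simp [hx', hy']⟩
  | inv c _ hc =>
    obtain ⟨x, hx, hx'⟩ := hc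
    exact ⟨-x, by simp [hx], by simp [hx']⟩

theorem neg_one_notMem_stabilizerGroup [Finite V]
    (hphase : ∀ a, σ (MG.gen G (.phase a)) = scalar Q a)
    (hker : LinearMap.ker (o.bitsMap σ) ≤ Submodule.span (ZMod 2)
      {x | ∃ (v : V) (p : G.Walk v v), σ (cycleElement G p) = 1 ∧ x = o.chain p}) :
    scalar Q 2 ∉ stabilizerGroup σ := by
  rintro ⟨c, hc, hσc⟩
  let T := {c | ∃ (v : V) (p : G.Walk v v), σ (cycleElement G p) = 1 ∧ c = cycleElement G p}
  have hT : Subgroup.closure T ≤ cycleGroup G ⊓ σ.ker := (Subgroup.closure_le _).2 <| by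
    rintro _ ⟨v, p, hp, rfl⟩
    exact ⟨Subgroup.subset_closure ⟨v, p, rfl⟩, hp⟩
  obtain ⟨x, hx, hx'⟩ := exists_chain_of_mem_cycleGroup o hphase hc
  have hxT : o.chainClass x ∈
      Submodule.span (ZMod 2) ((fun c => (unsign G c).toAdd) '' T) := by
    have hmem := Submodule.mem_map_of_mem (f := o.chainClass)
      (hker (show x ∈ LinearMap.ker (o.bitsMap σ) by rw [LinearMap.mem_ker, hx', hσc]; rfl))
    rw [Submodule.map_span] at hmem
    refine Submodule.span_mono ?_ hmem
    rintro _ ⟨_, ⟨v, p, hp, rfl⟩, rfl⟩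
    exact ⟨_, ⟨v, p, hp, rfl⟩, o.unsign_walkElement p⟩
  obtain ⟨c', hc', h⟩ := (mem_span_zmod_image_iff (unsign G)).1 hxT
  have hsign : c'⁻¹ * c ∈ signs G := unsign_eq_unsign_iff.1 (h.trans hx)
  have hone := Subgroup.disjoint_def.1 (disjoint_cycleGroup_signs G)
    (mul_mem (inv_mem (hT hc').1) hc) hsign
  rw [← inv_mul_eq_one.1 hone, (hT hc').2] at hσc
  exact absurd (congrArg phase hσc) (by decide : (0 : ZMod 4) ≠ 2)

end Encodings

/-! ## Squares and triangles of the tiling -/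

theorem dir_add_three (j : ZMod 6) : dir (j + 3) = -dir j := by revert j; decide

theorem dir_ne_zero (j : ZMod 6) : dir j ≠ 0 := by revert j; decide

theorem dir_add_five (j : ZMod 6) : dir (j + 1) + dir (j + 5) = dir j := by revert j; decide

/-- The other vertex with two outgoing arrows in the square that contains the outgoing arrows
of `u`. -/
def partner (u : Vertex) : Vertex := (u.1 + dir (u.2 + 1), u.2 + 3)

/-- The square that contains the outgoing arrows of `u`. -/
def squareOf (u : Vertex) : Finset Vertex := square u.1 (u.2 + 1)

/-- The triangle that contains `u`. -/
def triangleOf (u : Vertex) : Finset Vertex := triangle u.1 u.2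

theorem partner_partner (u : Vertex) : partner (partner u) = u := by
  refine Prod.ext ?_ ?_
  · change u.1 + dir (u.2 + 1) + dir (u.2 + 3 + 1) = u.1
    rw [add_right_comm u.2 3 1, dir_add_three, add_neg_cancel_right]
  · change u.2 + 3 + 3 = u.2
    rw [add_assoc]
    exact add_zero _

theorem hexNext_partner (u : Vertex) : hexNext (partner u) = triNext u :=
  Prod.ext rfl (add_assoc _ _ _)

theorem triNext_partner (u : Vertex) : triNext (partner u) = hexNext u := by
  rw [← hexNext_partner, partner_partner]

theorem triNext_triNext (u : Vertex) : triNext (triNext u) = (u.1 + dir u.2, u.2 + 2) := by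
  refine Prod.ext ?_ ?_
  · change u.1 + dir (u.2 + 1) + dir (u.2 + 4 + 1) = u.1 + dir u.2
    rw [add_assoc, add_assoc u.2]
    exact congrArg _ (dir_add_five u.2)
  · exact add_assoc _ _ _

theorem triNext_triNext_triNext (u : Vertex) : triNext (triNext (triNext u)) = u := by
  rw [triNext_triNext]
  refine Prod.ext ?_ ?_
  · change u.1 + dir (u.2 + 1) + dir (u.2 + 4) = u.1
    rw [show u.2 + 4 = u.2 + 1 + 3 by rw [add_assoc]; rfl, dir_add_three, add_neg_cancel_right]
  · change u.2 + 4 + 2 = u.2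
    rw [add_assoc]
    exact add_zero _

theorem hexNext_injective : Function.Injective hexNext := fun _ _ h =>
  Prod.ext (congrArg Prod.fst h :) (add_right_cancel (congrArg Prod.snd h :))

theorem triNext_injective : Function.Injective triNext := fun u w h => by
  rw [← triNext_triNext_triNext u, h, triNext_triNext_triNext]

theorem triNext_fst_ne (u : Vertex) : (triNext u).1 ≠ u.1 := fun h =>
  dir_ne_zero _ (add_eq_left.1 h)

theorem partner_fst_ne (u : Vertex) : (partner u).1 ≠ u.1 := fun h =>
  dir_ne_zero _ (add_eq_left.1 h)

theorem partner_ne (u : Vertex) : partner u ≠ u := fun h => partner_fst_ne u (by rw [h])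

theorem triNext_ne (u : Vertex) : triNext u ≠ u := fun h => triNext_fst_ne u (by rw [h])

theorem hexNext_ne (u : Vertex) : hexNext u ≠ u := fun h =>
  absurd (add_eq_left.1 (congrArg Prod.snd h :)) (by decide)

theorem hexNext_ne_triNext (u : Vertex) : hexNext u ≠ triNext u := fun h =>
  triNext_fst_ne u (congrArg Prod.fst h).symm

theorem hexNext_hexNext_ne (u : Vertex) : hexNext (hexNext u) ≠ u := fun h =>
  absurd (add_eq_left.1 ((add_assoc _ _ _).symm.trans (congrArg Prod.snd h :))) (by decide)

theorem triNext_triNext_ne (u : Vertex) : triNext (triNext u) ≠ u := fun h =>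
  absurd (add_eq_left.1 ((add_assoc _ _ _).symm.trans (congrArg Prod.snd h :))) (by decide)

theorem squareOf_eq (u : Vertex) : squareOf u = {u, hexNext u, partner u, triNext u} := by
  have h3 : u.2 + 1 + 2 = u.2 + 3 := add_assoc _ _ _
  have h4 : u.2 + 1 + 3 = u.2 + 4 := add_assoc _ _ _
  rw [squareOf, square, add_sub_cancel_right, h3, h4]
  rfl

theorem triangleOf_eq (u : Vertex) :
    triangleOf u = {u, triNext u, triNext (triNext u)} := by
  rw [triNext_triNext, triangleOf, triangle, Finset.pair_comm]
  rfl

theorem mem_squareOf {u v : Vertex} :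
    v ∈ squareOf u ↔ v = u ∨ v = hexNext u ∨ v = partner u ∨ v = triNext u := by
  simp [squareOf_eq]

theorem mem_triangleOf {u v : Vertex} :
    v ∈ triangleOf u ↔ v = u ∨ v = triNext u ∨ v = triNext (triNext u) := by
  simp [triangleOf_eq]

theorem mem_hexagon {x : ℤ × ℤ} {v : Vertex} : v ∈ hexagon x ↔ v.1 = x := by
  rw [hexagon, Finset.mem_image]
  exact ⟨by rintro ⟨k, -, rfl⟩; rfl, fun h => ⟨v.2, Finset.mem_univ _, Prod.ext h.symm rfl⟩⟩

theorem squareOf_partner (u : Vertex) : squareOf (partner u) = squareOf u := by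
  ext v
  rw [mem_squareOf, mem_squareOf, partner_partner, hexNext_partner, triNext_partner]
  tauto

theorem triangleOf_triNext (u : Vertex) : triangleOf (triNext u) = triangleOf u := by
  ext v
  rw [mem_triangleOf, mem_triangleOf, triNext_triNext_triNext]
  tauto

theorem triangleOf_eq_of_mem {u v : Vertex} (h : v ∈ triangleOf u) :
    triangleOf v = triangleOf u := by
  rcases mem_triangleOf.1 h with rfl | rfl | rfl
  · rfl
  · exact triangleOf_triNext u
  · rw [triangleOf_triNext, triangleOf_triNext]

theorem exists_mem_triangleOf_fst_eq {u v w : Vertex} (hu : u ∈ squareOf w) (hv : v ∈ squareOf w) :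
    ∃ t ∈ triangleOf u, t.1 = v.1 := by
  have hmeets (w : Vertex) (hu : u = w ∨ u = hexNext w) :
      (∃ t ∈ triangleOf u, t.1 = w.1) ∧ ∃ t ∈ triangleOf u, t.1 = (partner w).1 := by
    have hself : u ∈ triangleOf u := mem_triangleOf.2 (.inl rfl)
    rcases hu with rfl | rfl
    · exact ⟨⟨u, hself, rfl⟩, triNext u, mem_triangleOf.2 (.inr (.inl rfl)), rfl⟩
    · refine ⟨⟨_, hself, rfl⟩, partner w, mem_triangleOf.2 (.inr (.inr ?_)), rfl⟩
      rw [← triNext_partner, triNext_triNext_triNext]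
  have hmeets' : (∃ t ∈ triangleOf u, t.1 = w.1) ∧ ∃ t ∈ triangleOf u, t.1 = (partner w).1 := by
    rcases mem_squareOf.1 hu with h | h | h | h
    · exact hmeets w (.inl h)
    · exact hmeets w (.inr h)
    · exact (partner_partner w ▸ hmeets (partner w) (.inl h)).symm
    · exact (partner_partner w ▸
        hmeets (partner w) (.inr (h.trans (hexNext_partner w).symm))).symm
  rcases mem_squareOf.1 hv with rfl | rfl | rfl | rfl
  exacts [hmeets'.1, hmeets'.1, hmeets'.2, hmeets'.2]

theorem eq_of_hexNext_mem_squareOf {u w : Vertex} (h : u ∈ squareOf w)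
    (h' : hexNext u ∈ squareOf w) : u = w ∨ u = partner w := by
  have key : ∀ w, u = hexNext w → hexNext u ∈ squareOf w → False := by
    rintro w rfl h
    rcases mem_squareOf.1 h with h | h | h | h
    · exact hexNext_hexNext_ne _ h
    · exact hexNext_ne _ h
    · exact partner_fst_ne w (congrArg Prod.fst h).symm
    · exact triNext_fst_ne w (congrArg Prod.fst h).symm
  rcases mem_squareOf.1 h with h | h | h | h
  · exact .inl h
  · exact (key w h h').elim
  · exact .inr h
  · rw [← hexNext_partner] at h
    rw [← squareOf_partner] at h'
    exact (key _ h h').elim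

theorem squareOf_eq_iff {u w : Vertex} : squareOf u = squareOf w ↔ u = w ∨ u = partner w := by
  constructor
  · intro h
    apply eq_of_hexNext_mem_squareOf <;> rw [← h, mem_squareOf] <;> simp
  · rintro (rfl | rfl)
    · rfl
    · exact squareOf_partner w

theorem isSquare_squareOf (u : Vertex) : IsSquare (squareOf u) := ⟨_, _, rfl⟩

theorem exists_squareOf {f : Finset Vertex} (h : IsSquare f) : ∃ u, f = squareOf u := by
  obtain ⟨x, j, rfl⟩ := h
  exact ⟨(x, j - 1), by rw [squareOf, sub_add_cancel]⟩

theorem exists_triangleOf {f : Finset Vertex} (h : IsTriangle f) : ∃ u, f = triangleOf u := by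
  obtain ⟨x, k, rfl⟩ := h
  exact ⟨(x, k), rfl⟩

theorem isFace_squareOf (u : Vertex) : IsFace (squareOf u) := .inr (.inl (isSquare_squareOf u))

theorem isFace_triangleOf (u : Vertex) : IsFace (triangleOf u) := .inr (.inr ⟨_, _, rfl⟩)

theorem tiling_adj_hexNext (u : Vertex) : tiling.Adj u (hexNext u) :=
  (SimpleGraph.fromRel_adj _ _ _).2 ⟨(hexNext_ne u).symm, .inl (.inl rfl)⟩

theorem tiling_adj_triNext (u : Vertex) : tiling.Adj u (triNext u) :=
  (SimpleGraph.fromRel_adj _ _ _).2 ⟨(triNext_ne u).symm, .inl (.inr rfl)⟩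

/-! ## The arrows of a lattice -/

/-- The sets of faces of the tiling that are determined by their hexagons: a face belongs to the
lattice if and only if it shares a vertex with a hexagon of the lattice. -/
structure IsLattice (F : Finset (Finset Vertex)) : Prop where
  isFace : ∀ f ∈ F, IsFace f
  hexagonsSurrounded : HexagonsSurrounded F
  madeOfHexagons : MadeOfHexagons F

section Lattice

variable {F : Finset (Finset Vertex)}

theorem mem_vertices_of_mem {f : Finset Vertex} (hf : f ∈ F) {u : Vertex} (hu : u ∈ f) :
    u ∈ F.biUnion id :=
  Finset.mem_biUnion.2 ⟨f, hf, hu⟩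

namespace IsLattice

theorem mem_iff (hF : IsLattice F) {f : Finset Vertex} (hf : IsFace f) :
    f ∈ F ↔ ∃ v ∈ f, hexagon v.1 ∈ F := by
  constructor
  · intro h
    obtain ⟨_, hx, ⟨x, rfl⟩, v, hv⟩ := hF.madeOfHexagons f h
    rw [Finset.mem_inter, mem_hexagon] at hv
    exact ⟨v, hv.1, hv.2 ▸ hx⟩
  · rintro ⟨v, hv, h⟩
    exact hF.hexagonsSurrounded _ h ⟨_, rfl⟩ f hf
      ⟨v, Finset.mem_inter.2 ⟨hv, mem_hexagon.2 rfl⟩⟩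

theorem mem_vertices_iff (hF : IsLattice F) {u : Vertex} :
    u ∈ F.biUnion id ↔ triangleOf u ∈ F := by
  refine ⟨fun h => ?_, fun h => mem_vertices_of_mem h (mem_triangleOf.2 (.inl rfl))⟩
  obtain ⟨f, hf, hu : u ∈ f⟩ := Finset.mem_biUnion.1 h
  rcases hF.isFace f hf with ⟨x, rfl⟩ | hsquare | htriangle
  · exact (hF.mem_iff (isFace_triangleOf u)).2
      ⟨u, mem_triangleOf.2 (.inl rfl), (mem_hexagon.1 hu).symm ▸ hf⟩
  · obtain ⟨w, rfl⟩ := exists_squareOf hsquare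
    obtain ⟨v, hv, hvF⟩ := (hF.mem_iff (isFace_squareOf w)).1 hf
    obtain ⟨t, ht, htv⟩ := exists_mem_triangleOf_fst_eq hu hv
    exact (hF.mem_iff (isFace_triangleOf u)).2 ⟨t, ht, htv ▸ hvF⟩
  · obtain ⟨w, rfl⟩ := exists_triangleOf htriangle
    rwa [triangleOf_eq_of_mem hu]

theorem triNext_mem (hF : IsLattice F) {u : Vertex} (hu : u ∈ F.biUnion id) :
    triNext u ∈ F.biUnion id := by
  rw [hF.mem_vertices_iff] at hu ⊢
  rwa [triangleOf_triNext]

theorem squareOf_mem_of_hexNext_mem (hF : IsLattice F) {f : Finset Vertex} (hf : f ∈ F)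
    {u : Vertex} (hu : u ∈ f) (hu' : hexNext u ∈ f) : squareOf u ∈ F := by
  rcases hF.isFace f hf with ⟨x, rfl⟩ | hsquare | htriangle
  · exact (hF.mem_iff (isFace_squareOf u)).2
      ⟨u, mem_squareOf.2 (.inl rfl), (mem_hexagon.1 hu).symm ▸ hf⟩
  · obtain ⟨w, rfl⟩ := exists_squareOf hsquare
    rwa [squareOf_eq_iff.2 (eq_of_hexNext_mem_squareOf hu hu')]
  · obtain ⟨w, rfl⟩ := exists_triangleOf htriangle
    rw [← triangleOf_eq_of_mem hu] at hu'
    rcases mem_triangleOf.1 hu' with h | h | h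
    · exact absurd h (hexNext_ne u)
    · exact absurd h (hexNext_ne_triNext u)
    · rw [triNext_triNext] at h
      exact absurd (add_eq_left.1 (congrArg Prod.fst h).symm) (dir_ne_zero _)

end IsLattice

variable (F) in
/-- The square faces of the lattice. -/
abbrev SquareFace : Type := {f : F // IsSquare f.1}

variable (F) in
/-- The sources of the arrows along hexagons. -/
abbrev HexSource : Type := {u : LatticeVertex F // squareOf u.1 ∈ F}

namespace HexSource

/-- The square that contains the arrows starting at `u`. -/
def square (u : HexSource F) : SquareFace F := ⟨⟨squareOf u.1.1, u.2⟩, isSquare_squareOf _⟩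

/-- The other source of arrows in the same square. -/
def partner (u : HexSource F) : HexSource F :=
  ⟨⟨FermionEncoding.partner u.1.1,
      mem_vertices_of_mem u.2 (mem_squareOf.2 (.inr (.inr (.inl rfl))))⟩,
    by rw [squareOf_partner]; exact u.2⟩

theorem squareOf_eq_iff {u : LatticeVertex F} {w : HexSource F} :
    squareOf u.1 = squareOf w.1.1 ↔ u = w.1 ∨ u = w.partner.1 := by
  rw [FermionEncoding.squareOf_eq_iff, Subtype.ext_iff, Subtype.ext_iff]
  rfl

theorem square_eq_iff {u w : HexSource F} : u.square = w.square ↔ u = w ∨ u = w.partner := by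
  rw [Subtype.ext_iff, Subtype.ext_iff, Subtype.ext_iff, Subtype.ext_iff (a1 := u)]
  exact squareOf_eq_iff

theorem partner_partner (u : HexSource F) : u.partner.partner = u :=
  Subtype.ext (Subtype.ext (FermionEncoding.partner_partner _))

theorem partner_ne (u : HexSource F) : u.partner ≠ u := fun h =>
  FermionEncoding.partner_ne u.1.1 (congrArg (fun w : HexSource F => w.1.1) h)

theorem squareOf_partner (u : HexSource F) : squareOf u.partner.1.1 = squareOf u.1.1 :=
  FermionEncoding.squareOf_partner _

theorem square_surjective : Function.Surjective (square (F := F)) := by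
  rintro ⟨⟨f, hf⟩, h⟩
  obtain ⟨u, rfl⟩ := exists_squareOf h
  exact ⟨⟨⟨u, mem_vertices_of_mem hf (mem_squareOf.2 (.inl rfl))⟩, hf⟩, rfl⟩

theorem card_eq : Fintype.card (HexSource F) = 2 * Fintype.card (SquareFace F) := by
  classical
  have hfiber (f : SquareFace F) : (Finset.univ.filter fun u : HexSource F => u.square = f).card =
      2 := by
    obtain ⟨u, rfl⟩ := square_surjective f
    rw [← Finset.card_pair u.partner_ne.symm]
    congr 1
    ext w
    simp [square_eq_iff]
  rw [← Finset.card_univ, Finset.card_eq_sum_card_fiberwise (f := square) (t := Finset.univ)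
    (fun _ _ => Finset.mem_coe.2 (Finset.mem_univ _)), Finset.sum_congr rfl fun f _ => hfiber f,
    Finset.sum_const, smul_eq_mul, mul_comm, Finset.card_univ]

end HexSource

variable (F) in
/-- The arrows of the lattice, labelled by their sources: those along triangles and those along
hexagons. -/
abbrev Arrow : Type := LatticeVertex F ⊕ HexSource F

namespace Arrow

/-- The source of an arrow. -/
def src : Arrow F → LatticeVertex F
  | .inl u => u
  | .inr u => u.1

/-- The target of an arrow. -/
def tgt (hF : IsLattice F) : Arrow F → LatticeVertex F
  | .inl u => ⟨triNext u.1, hF.triNext_mem u.2⟩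
  | .inr u => ⟨hexNext u.1.1, mem_vertices_of_mem u.2 (mem_squareOf.2 (.inr (.inl rfl)))⟩

variable (hF : IsLattice F)

theorem adj (a : Arrow F) : (latticeGraph F).Adj a.src (a.tgt hF) := by
  rcases a with u | u
  · exact ⟨tiling_adj_triNext _, _, hF.mem_vertices_iff.1 u.2, mem_triangleOf.2 (.inl rfl),
      mem_triangleOf.2 (.inr (.inl rfl))⟩
  · exact ⟨tiling_adj_hexNext _, _, u.2, mem_squareOf.2 (.inl rfl),
      mem_squareOf.2 (.inr (.inl rfl))⟩

/-- An arrow as a directed edge of the lattice. -/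
def dart (a : Arrow F) : (latticeGraph F).Dart := ⟨(a.src, a.tgt hF), a.adj hF⟩

theorem eq_dart_inl {d : (latticeGraph F).Dart} (h : d.snd.1 = triNext d.fst.1) :
    d = dart hF (.inl d.fst) :=
  SimpleGraph.Dart.ext _ _ (Prod.ext rfl (Subtype.ext h))

theorem exists_eq_dart_inr {d : (latticeGraph F).Dart} (h : d.snd.1 = hexNext d.fst.1) :
    ∃ u : HexSource F, d = dart hF (.inr u) := by
  obtain ⟨-, f, hf, hu, hw⟩ := d.adj
  exact ⟨⟨d.fst, hF.squareOf_mem_of_hexNext_mem hf hu (h ▸ hw)⟩,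
    SimpleGraph.Dart.ext _ _ (Prod.ext rfl (Subtype.ext h))⟩

theorem exists_edge_dart_eq (d : (latticeGraph F).Dart) :
    ∃ a : Arrow F, (a.dart hF).edge = d.edge := by
  have hdart {d : (latticeGraph F).Dart}
      (h : d.snd.1 = hexNext d.fst.1 ∨ d.snd.1 = triNext d.fst.1) :
      ∃ a : Arrow F, d = a.dart hF := by
    rcases h with h | h
    · exact (exists_eq_dart_inr hF h).imp' .inr fun _ => id
    · exact ⟨_, eq_dart_inl hF h⟩
  rcases ((SimpleGraph.fromRel_adj _ _ _).1 d.adj.1).2 with h | h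
  · obtain ⟨a, rfl⟩ := hdart h
    exact ⟨a, rfl⟩
  · obtain ⟨a, ha⟩ := hdart (d := d.symm) h
    exact ⟨a, by rw [← ha, SimpleGraph.Dart.edge_symm]⟩

theorem dart_injective : Function.Injective (dart hF) := by
  intro a b h
  have hsrc : a.src = b.src := congrArg (·.fst) h
  have htgt : (a.tgt hF).1 = (b.tgt hF).1 := congrArg (·.snd.1) h
  rcases a with u | u <;> rcases b with w | w
  · exact congrArg _ hsrc
  · obtain rfl : u = w.1 := hsrc
    exact absurd htgt.symm (hexNext_ne_triNext _)
  · obtain rfl : u.1 = w := hsrc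
    exact absurd htgt (hexNext_ne_triNext _)
  · exact congrArg _ (Subtype.ext hsrc)

theorem dart_ne_symm (a b : Arrow F) : a.dart hF ≠ (b.dart hF).symm := by
  intro h
  have h₁ : a.src.1 = (b.tgt hF).1 := congrArg (·.fst.1) h
  have h₂ : (a.tgt hF).1 = b.src.1 := congrArg (·.snd.1) h
  rcases a with u | u <;> rcases b with w | w <;> simp only [src, tgt] at h₁ h₂
  · rw [h₁] at h₂
    exact triNext_triNext_ne _ h₂
  · rw [h₁] at h₂
    exact triNext_fst_ne (hexNext w.1.1) (congrArg Prod.fst h₂ :)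
  · rw [← h₂] at h₁
    exact triNext_fst_ne (hexNext u.1.1) (congrArg Prod.fst h₁ :).symm
  · rw [h₁] at h₂
    exact hexNext_hexNext_ne _ h₂

/-- The orientation of the edges of the lattice by the arrows. -/
def orientation : EdgeOrientation (latticeGraph F) (Arrow F) where
  dart := dart hF
  existsUnique_edge_eq d := by
    refine existsUnique_of_exists_of_unique (exists_edge_dart_eq hF d) fun a b ha hb => ?_
    rcases SimpleGraph.dart_edge_eq_iff _ _ |>.1 (ha.trans hb.symm) with h | h
    · exact dart_injective hF h
    · exact absurd h (dart_ne_symm hF a b)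

theorem tgt_inl_partner (u : HexSource F) : tgt hF (.inl u.partner.1) = tgt hF (.inr u) :=
  Subtype.ext (triNext_partner u.1.1)

theorem tgt_inr_partner (u : HexSource F) : tgt hF (.inr u.partner) = tgt hF (.inl u.1) :=
  Subtype.ext (hexNext_partner u.1.1)

theorem tgt_inl_injective : Function.Injective fun u => tgt hF (.inl u) := fun _ _ h =>
  Subtype.ext (triNext_injective (congrArg Subtype.val h))

theorem tgt_inr_injective : Function.Injective fun u => tgt hF (.inr u) := fun _ _ h =>
  Subtype.ext (Subtype.ext (hexNext_injective (congrArg Subtype.val h)))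

end Arrow

end Lattice

/-! ## The edge operators -/

section Strings

open PauliGroup

variable {F : Finset (Finset Vertex)}

theorem xBit_edgeString_inl {u w : LatticeVertex F} (h : u ≠ w) (P : Pauli)
    (v : LatticeVertex F) :
    (edgeString F u w P (.inl v)).xBit = (Pi.single u 1 + Pi.single w 1 : _ → ZMod 2) v := by
  by_cases hu : v = u
  · simp [edgeString, hu, h, Pauli.xBit]
  · by_cases hw : v = w <;> simp [edgeString, hu, hw, h.symm, Pauli.xBit]

theorem zBit_edgeString_inl {u w : LatticeVertex F} (h : u ≠ w) (P : Pauli)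
    (v : LatticeVertex F) :
    (edgeString F u w P (.inl v)).zBit = (Pi.single w 1 : _ → ZMod 2) v := by
  by_cases hu : v = u
  · simp [edgeString, hu, h, Pauli.zBit]
  · by_cases hw : v = w <;> simp [edgeString, hu, hw, h.symm, Pauli.zBit]

theorem edgeString_inr (u w : LatticeVertex F) (P : Pauli) (f : SquareFace F) :
    edgeString F u w P (.inr f) = if f.1.1 = squareOf u.1 then P else .I := by
  unfold edgeString squareOf
  congr

theorem form_vertexString (s t : ZMod 4) (v w : LatticeVertex F) :
    form ⟨s, vertexString F v⟩ ⟨t, vertexString F w⟩ = 0 := by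
  refine Finset.sum_eq_zero fun q _ => ?_
  rcases q with x | f
  · simp only [vertexString]
    split_ifs <;> rfl
  · rfl

/-- The Pauli string `X_u X_{u'} Z_f`, where `f` is the square of `u` and `u'` is the other source
in it. Up to a phase, it is the product of the operators of two consecutive sides of `f`. -/
noncomputable def diagonalString (u : HexSource F) : Qubit F → Pauli
  | .inl v => if v = u.1 ∨ v = u.partner.1 then .X else .I
  | .inr f => if f.1.1 = squareOf u.1.1 then .Z else .I

theorem diagonalString_partner (u : HexSource F) :
    diagonalString u.partner = diagonalString u := by
  funext q
  rcases q with v | f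
  · simp only [diagonalString, HexSource.partner_partner, or_comm]
  · exact if_congr (by rw [u.squareOf_partner]) rfl rfl

theorem edgeString_mul_edgeString (u : HexSource F) {w : LatticeVertex F} (h : u.1 ≠ w)
    (h' : u.partner.1 ≠ w) (s t : ZMod 4) :
    (⟨s, edgeString F u.1 w .X⟩ : PauliGroup (Qubit F)) * ⟨t, edgeString F u.partner.1 w .Y⟩ =
      ⟨s + t + 1, diagonalString u⟩ := by
  have hne : u.1 ≠ u.partner.1 := fun h => u.partner_ne (Subtype.ext h.symm)
  have hvertex (v : LatticeVertex F) :
      (edgeString F u.1 w .X (.inl v)).mulPhase (edgeString F u.partner.1 w .Y (.inl v)) = 0 ∧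
      (edgeString F u.1 w .X (.inl v)).mulOp (edgeString F u.partner.1 w .Y (.inl v)) =
        diagonalString u (.inl v) := by
    by_cases hu : v = u.1
    · simp [edgeString, diagonalString, hu, h, hne]
    by_cases hu' : v = u.partner.1
    · simp [edgeString, diagonalString, hu', h', hne.symm]
    · simp [edgeString, diagonalString, hu, hu', Pauli.mulPhase_self, Pauli.mulOp_self]
  have hsquare (f : SquareFace F) :
      (edgeString F u.1 w .X (.inr f)).mulPhase (edgeString F u.partner.1 w .Y (.inr f)) =
        (if f = u.square then 1 else 0) ∧
      (edgeString F u.1 w .X (.inr f)).mulOp (edgeString F u.partner.1 w .Y (.inr f)) =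
        diagonalString u (.inr f) := by
    rw [edgeString_inr, edgeString_inr, u.squareOf_partner, diagonalString]
    by_cases hf : f = u.square
    · simp only [hf, HexSource.square, if_true]
      exact ⟨rfl, rfl⟩
    · have hf' : f.1.1 ≠ squareOf u.1.1 := fun h => hf (Subtype.ext (Subtype.ext h))
      simp [hf, hf']
  refine PauliGroup.ext ?_ (funext fun q => ?_)
  · simp [hvertex, hsquare]
  · rcases q with v | f
    · exact (hvertex v).2
    · exact (hsquare f).2

namespace Arrow

/-- The Pauli operator that an arrow applies to the qubit of its square. -/
def pauli : Arrow F → Pauli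
  | .inl _ => .Y
  | .inr _ => .X

/-- The sign of an arrow, as an exponent of `i`: of the two arrows along hexagons in a square, the
one that starts at direction `5`, `0` or `1` gets a minus sign. -/
def sign : Arrow F → ZMod 4
  | .inl _ => 0
  | .inr u => if u.1.1.2 = 5 ∨ u.1.1.2 = 0 ∨ u.1.1.2 = 1 then 2 else 0

theorem sign_eq (a : Arrow F) : a.sign = 0 ∨ a.sign = 2 := by
  rcases a with u | u
  · exact .inl rfl
  · exact (ite_eq_or_eq _ _ _).symm

theorem sign_add_sign_partner (u : HexSource F) : sign (.inr u) + sign (.inr u.partner) = 2 := by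
  have h : ∀ k : ZMod 6, (if k = 5 ∨ k = 0 ∨ k = 1 then (2 : ZMod 4) else 0) +
      (if k + 3 = 5 ∨ k + 3 = 0 ∨ k + 3 = 1 then 2 else 0) = 2 := by decide
  exact h u.1.1.2

variable (hF : IsLattice F)

/-- The edge operator of an arrow. -/
noncomputable def operator (a : Arrow F) : PauliGroup (Qubit F) :=
  ⟨a.sign, edgeString F a.src (a.tgt hF) a.pauli⟩

theorem operator_mul_self (a : Arrow F) : a.operator hF * a.operator hF = 1 := by
  rw [mul_eq_scalar_of_op_eq rfl]
  rcases a.sign_eq with h | h <;> rw [operator, h] <;> rfl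

theorem form_operator_vertexString (a : Arrow F) (s : ZMod 4) (k : LatticeVertex F) :
    form (a.operator hF) ⟨s, vertexString F k⟩ = ends (a.dart hF) k := by
  have hx (v : LatticeVertex F) : (vertexString F k (.inl v)).xBit = 0 := by
    by_cases h : v = k <;> simp [vertexString, h, Pauli.xBit]
  have hz (v : LatticeVertex F) :
      (vertexString F k (.inl v)).zBit = (Pi.single k 1 : _ → ZMod 2) v := by
    by_cases h : v = k <;> simp [vertexString, h, Pauli.zBit]
  have hsquare (f : SquareFace F) (p : Pauli) : p.form (vertexString F k (.inr f)) = 0 := by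
    simp [vertexString, Pauli.form, Pauli.xBit, Pauli.zBit]
  rw [form, Fintype.sum_sum_type, Fintype.sum_eq_zero _ fun f => hsquare f _, add_zero,
    Fintype.sum_eq_single k fun v h => by simp [Pauli.form, hx, hz, h]]
  simp [Pauli.form, hx, hz, operator, xBit_edgeString_inl (a.adj hF).ne, ends, dart]

theorem sum_form_operator_inl (a b : Arrow F) :
    ∑ v, ((a.operator hF).op (.inl v)).form ((b.operator hF).op (.inl v)) =
      (Pi.single (b.tgt hF) 1 : _ → ZMod 2) a.src +
        (Pi.single b.src 1 : _ → ZMod 2) (a.tgt hF) := by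
  have hsum (g : LatticeVertex F → ZMod 2) (w : LatticeVertex F) :
      ∑ v, g v * (Pi.single w 1 : _ → ZMod 2) v = g w :=
    (Fintype.sum_eq_single w fun v h => by simp [h]).trans (by simp)
  simp only [Pauli.form, operator, xBit_edgeString_inl (adj hF _).ne,
    zBit_edgeString_inl (adj hF _).ne, Finset.sum_add_distrib,
    mul_comm ((Pi.single (a.tgt hF) 1 : _ → ZMod 2) _), hsum, Pi.add_apply]
  rw [Pi.single_comm a.src, Pi.single_comm (a.tgt hF), add_comm, add_add_add_comm,
    CharTwo.add_self_eq_zero, add_zero, add_comm]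

theorem sum_form_operator_inr_of_pauli_eq {a b : Arrow F} (h : a.pauli = b.pauli) :
    ∑ f, ((a.operator hF).op (.inr f)).form ((b.operator hF).op (.inr f)) = 0 := by
  refine Finset.sum_eq_zero fun f _ => ?_
  simp only [operator, edgeString_inr, h]
  split_ifs <;> cases b.pauli <;> rfl

theorem sum_form_operator_inl_inr (u : LatticeVertex F) (w : HexSource F) :
    ∑ f, ((operator hF (.inl u)).op (.inr f)).form ((operator hF (.inr w)).op (.inr f)) =
      if u = w.1 ∨ u = w.partner.1 then 1 else 0 := by
  simp only [operator, edgeString_inr, src, pauli]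
  refine (Fintype.sum_eq_single w.square fun f hf => ?_).trans ?_
  · have hf' : f.1.1 ≠ squareOf w.1.1 := fun h => hf (Subtype.ext (Subtype.ext h))
    rw [if_neg hf']
    simp [Pauli.form, Pauli.xBit, Pauli.zBit]
  · simp only [HexSource.square, if_true, eq_comm (a := squareOf w.1.1),
      HexSource.squareOf_eq_iff]
    split_ifs <;> rfl

theorem sum_form_operator_inr (a b : Arrow F) :
    ∑ f, ((a.operator hF).op (.inr f)).form ((b.operator hF).op (.inr f)) =
      (Pi.single b.src 1 : _ → ZMod 2) a.src +
        (Pi.single (b.tgt hF) 1 : _ → ZMod 2) (a.tgt hF) := by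
  have hmixed (u : LatticeVertex F) (w : HexSource F) :
      (if u = w.1 ∨ u = w.partner.1 then 1 else 0) = (Pi.single w.1 1 : _ → ZMod 2) u +
        (Pi.single (tgt hF (.inr w)) 1 : _ → ZMod 2) (tgt hF (.inl u)) := by
    have hne : w.1 ≠ w.partner.1 := fun h => w.partner_ne (Subtype.ext h.symm)
    rw [← tgt_inl_partner]
    simp only [Pi.single_apply, (tgt_inl_injective hF).eq_iff]
    by_cases h : u = w.1 <;> simp [h, hne]
  rcases a with u | u <;> rcases b with w | w
  · rw [sum_form_operator_inr_of_pauli_eq hF (show pauli (.inl u) = pauli (.inl w) from rfl)]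
    simp only [Pi.single_apply, (tgt_inl_injective hF).eq_iff, src, CharTwo.add_self_eq_zero]
  · rw [sum_form_operator_inl_inr, hmixed]
    rfl
  · simp only [Pauli.form_comm ((operator hF (.inr u)).op _), sum_form_operator_inl_inr, hmixed]
    exact congrArg₂ (· + ·) (Pi.single_comm u.1 1 w) (Pi.single_comm _ _ _)
  · rw [sum_form_operator_inr_of_pauli_eq hF (show pauli (.inr u) = pauli (.inr w) from rfl)]
    simp only [Pi.single_apply, (tgt_inr_injective hF).eq_iff, src, ← Subtype.ext_iff,
      CharTwo.add_self_eq_zero]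

theorem form_operator (a b : Arrow F) : form (a.operator hF) (b.operator hF) =
    ends (b.dart hF) a.src + ends (b.dart hF) (a.tgt hF) := by
  rw [form, Fintype.sum_sum_type, sum_form_operator_inl, sum_form_operator_inr]
  simp only [ends, dart, Pi.add_apply]
  ring

end Arrow

end Strings

/-! ## The cycles of the squares -/

section SquareCycles

open PauliGroup

variable {F : Finset (Finset Vertex)}

namespace SquareFace

/-- The chain of the four sides of a square of the lattice. -/
def cycle (f : SquareFace F) : Arrow F → ZMod 2 :=
  fun a => if squareOf a.src.1 = f.1.1 then 1 else 0

theorem cycle_square (u : HexSource F) : cycle u.square =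
    Pi.single (.inr u) 1 + Pi.single (.inl u.partner.1) 1 +
      (Pi.single (.inr u.partner) 1 + Pi.single (.inl u.1) 1) := by
  have hne : u.1 ≠ u.partner.1 := fun h => u.partner_ne (Subtype.ext h.symm)
  funext a
  rcases a with w | w
  · by_cases h : w = u.1 <;>
      simp [cycle, HexSource.square, Arrow.src, HexSource.squareOf_eq_iff, Pi.single_apply, h, hne]
  · by_cases h : w = u <;>
      simp [cycle, HexSource.square, Arrow.src, HexSource.squareOf_eq_iff, Pi.single_apply, h,
        ← Subtype.ext_iff, u.partner_ne.symm]

theorem sum_smul_cycle_apply (c : SquareFace F → ZMod 2) {a : Arrow F} {f : SquareFace F}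
    (h : squareOf a.src.1 = f.1.1) : (∑ g, c g • g.cycle) a = c f := by
  rw [Finset.sum_apply, Fintype.sum_eq_single f fun g hg => ?_]
  · simp [cycle, h]
  · have hg' : f.1.1 ≠ g.1.1 := fun h => hg (Subtype.ext (Subtype.ext h.symm))
    simp [cycle, h, hg']

theorem linearIndependent_cycle : LinearIndependent (ZMod 2) (cycle (F := F)) := by
  refine Fintype.linearIndependent_iff.2 fun c hc f => ?_
  obtain ⟨u, rfl⟩ := HexSource.square_surjective f
  exact (sum_smul_cycle_apply c (a := .inr u) rfl).symm.trans (congrFun hc _)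

end SquareFace

namespace Arrow

variable (hF : IsLattice F)

/-- The bits of the product of the operators of a chain of arrows. -/
noncomputable def stringMap : (Arrow F → ZMod 2) →ₗ[ZMod 2] (Qubit F → ZMod 2 × ZMod 2) :=
  Fintype.linearCombination (ZMod 2) fun a => (operator hF a).bits.toAdd

theorem stringMap_single (a : Arrow F) :
    stringMap hF (Pi.single a 1) = (operator hF a).bits.toAdd := by
  rw [stringMap, Fintype.linearCombination_apply_single, one_smul]

theorem operator_mul_square (u : HexSource F) :
    (operator hF (.inr u) * operator hF (.inl u.partner.1)) *
      (operator hF (.inr u.partner) * operator hF (.inl u.1)) = 1 := by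
  have hcorner (u : HexSource F) : operator hF (.inr u) * operator hF (.inl u.partner.1) =
      ⟨sign (.inr u) + 1, diagonalString u⟩ := by
    have h := (adj hF (.inl u.partner.1)).ne
    rw [operator, operator, tgt_inl_partner] at *
    exact (edgeString_mul_edgeString u (adj hF (.inr u)).ne h _ _).trans (by rw [sign, add_zero])
  have hcorner' := hcorner u.partner
  rw [HexSource.partner_partner, diagonalString_partner] at hcorner'
  have hsum : sign (.inr u) + 1 + (sign (.inr u.partner) + 1) = 0 := by
    rw [add_add_add_comm, sign_add_sign_partner]
    rfl
  calc _ = (⟨sign (.inr u) + 1, diagonalString u⟩ : PauliGroup (Qubit F)) *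
        ⟨sign (.inr u.partner) + 1, diagonalString u⟩ := congrArg₂ (· * ·) (hcorner u) hcorner'
    _ = scalar _ (sign (.inr u) + 1 + (sign (.inr u.partner) + 1)) := mul_eq_scalar_of_op_eq rfl
    _ = 1 := congrArg (scalar _) hsum

theorem stringMap_cycle (f : SquareFace F) : stringMap hF f.cycle = 0 := by
  obtain ⟨u, rfl⟩ := HexSource.square_surjective f
  have h := congrArg (fun a => a.bits.toAdd) (operator_mul_square hF u)
  simp only [map_mul, toAdd_mul, map_one, toAdd_one] at h
  simpa only [SquareFace.cycle_square, map_add, stringMap_single] using h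

theorem stringMap_inl (x : Arrow F → ZMod 2) (v : LatticeVertex F) : stringMap hF x (.inl v) =
    ((∑ a, if a.src = v then x a else 0) + ∑ a, if a.tgt hF = v then x a else 0,
      ∑ a, if a.tgt hF = v then x a else 0) := by
  have hbits (a : Arrow F) : (operator hF a).bits.toAdd (.inl v) =
      ((if a.src = v then 1 else 0) + (if a.tgt hF = v then 1 else 0),
        if a.tgt hF = v then 1 else 0) := by
    simp only [← Pi.single_apply v (1 : ZMod 2), Pi.single_comm v]
    exact Prod.ext (xBit_edgeString_inl (adj hF a).ne a.pauli v)
      (zBit_edgeString_inl (adj hF a).ne a.pauli v)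
  rw [stringMap, Fintype.linearCombination_apply, Finset.sum_apply]
  refine Prod.ext ?_ ?_
  · simp only [Prod.fst_sum, Pi.smul_apply, hbits, Prod.smul_fst, smul_eq_mul, mul_add, mul_ite,
      mul_one, mul_zero, Finset.sum_add_distrib]
  · simp only [Prod.snd_sum, Pi.smul_apply, hbits, Prod.smul_snd, smul_eq_mul, mul_ite, mul_one,
      mul_zero]

theorem sum_src_and_tgt_eq_zero_of_mem_ker {x : Arrow F → ZMod 2}
    (hx : x ∈ LinearMap.ker (stringMap hF)) (v : LatticeVertex F) :
    (∑ a : Arrow F, if a.src = v then x a else 0) = 0 ∧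
      (∑ a, if a.tgt hF = v then x a else 0) = 0 := by
  have h := (stringMap_inl hF x v).symm.trans (congrFun hx (.inl v))
  obtain ⟨hsrc, htgt⟩ := Prod.mk.inj h
  rw [htgt, add_zero] at hsrc
  exact ⟨hsrc, htgt⟩

theorem sum_src_eq (x : Arrow F → ZMod 2) (v : LatticeVertex F) :
    (∑ a : Arrow F, if a.src = v then x a else 0) =
      x (.inl v) + if h : squareOf v.1 ∈ F then x (.inr ⟨v, h⟩) else 0 := by
  rw [Fintype.sum_sum_type]
  congr 1
  · exact (Fintype.sum_eq_single v fun u hu => if_neg hu).trans (if_pos rfl)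
  · split_ifs with h
    · exact (Fintype.sum_eq_single (⟨v, h⟩ : HexSource F)
        fun u hu => if_neg fun h' => hu (Subtype.ext h')).trans (if_pos rfl)
    · exact Finset.sum_eq_zero fun u _ => if_neg fun h' : u.1 = v => h (h' ▸ u.2)

theorem sum_tgt_eq (x : Arrow F → ZMod 2) (u : HexSource F) :
    (∑ a, if a.tgt hF = tgt hF (.inl u.1) then x a else 0) =
      x (.inl u.1) + x (.inr u.partner) := by
  simp only [Fintype.sum_sum_type, (tgt_inl_injective hF).eq_iff]
  simp only [← tgt_inr_partner, (tgt_inr_injective hF).eq_iff, Finset.sum_ite_eq',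
    Finset.mem_univ, if_true]

theorem ker_stringMap :
    LinearMap.ker (stringMap hF) = Submodule.span (ZMod 2) (Set.range SquareFace.cycle) := by
  refine le_antisymm (fun x hx => ?_) (Submodule.span_le.2 ?_)
  · have hsrc (u : HexSource F) : x (.inl u.1) = x (.inr u) := by
      have h := (sum_src_and_tgt_eq_zero_of_mem_ker hF hx u.1).1
      rwa [sum_src_eq, dif_pos u.2, CharTwo.add_eq_zero] at h
    have htgt (u : HexSource F) : x (.inl u.1) = x (.inr u.partner) := by
      have h := (sum_src_and_tgt_eq_zero_of_mem_ker hF hx (tgt hF (.inl u.1))).2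
      rwa [sum_tgt_eq, CharTwo.add_eq_zero] at h
    have hconst : (fun u : HexSource F => x (.inr u)).FactorsThrough HexSource.square := by
      intro u w h
      rcases HexSource.square_eq_iff.1 h with rfl | rfl
      · rfl
      · exact (htgt w).symm.trans (hsrc w)
    obtain ⟨c, hc⟩ := (Function.factorsThrough_iff _).1 hconst
    refine Submodule.mem_span_range_iff_exists_fun _ |>.2 ⟨c, funext fun a => ?_⟩
    rcases a with v | u
    · by_cases h : squareOf v.1 ∈ F
      · let u : HexSource F := ⟨v, h⟩
        exact (SquareFace.sum_smul_cycle_apply c (f := u.square) rfl).trans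
          ((congrFun hc u).symm.trans (hsrc u).symm)
      · have hv := (sum_src_and_tgt_eq_zero_of_mem_ker hF hx v).1
        rw [sum_src_eq, dif_neg h, add_zero] at hv
        rw [hv, Finset.sum_apply]
        refine Finset.sum_eq_zero fun f _ => ?_
        have hf : squareOf v.1 ≠ f.1.1 := fun h' => h (h' ▸ f.1.2)
        simp [SquareFace.cycle, src, hf]
    · exact (SquareFace.sum_smul_cycle_apply c rfl).trans (congrFun hc u).symm
  · rintro _ ⟨f, rfl⟩
    exact stringMap_cycle hF f

theorem finrank_ker_stringMap :
    Module.finrank (ZMod 2) (LinearMap.ker (stringMap hF)) = Fintype.card (SquareFace F) := by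
  rw [ker_stringMap, finrank_span_eq_card SquareFace.linearIndependent_cycle]

/-- The closed walk around the square of `u`, starting along the hexagon of `u`. -/
def squareWalk (u : HexSource F) : (latticeGraph F).Walk u.1 u.1 :=
  .cons (v := tgt hF (.inr u)) (adj hF (.inr u))
    (.cons (v := u.partner.1) (tgt_inl_partner hF u ▸ (adj hF (.inl u.partner.1)).symm)
      (.cons (v := tgt hF (.inl u.1)) (tgt_inr_partner hF u ▸ adj hF (.inr u.partner))
        (.cons (adj hF (.inl u.1)).symm .nil)))

theorem darts_squareWalk (u : HexSource F) : (squareWalk hF u).darts =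
    [dart hF (.inr u), (dart hF (.inl u.partner.1)).symm, dart hF (.inr u.partner),
      (dart hF (.inl u.1)).symm] := by
  refine congrArg₂ List.cons rfl (congrArg₂ List.cons ?_ (congrArg₂ List.cons ?_ rfl))
  · exact SimpleGraph.Dart.ext _ _ (Prod.ext (tgt_inl_partner hF u).symm rfl)
  · exact SimpleGraph.Dart.ext _ _ (Prod.ext rfl (tgt_inr_partner hF u).symm)

theorem chain_squareWalk (u : HexSource F) :
    (orientation hF).chain (squareWalk hF u) = u.square.cycle := by
  have h : ∀ a, (orientation hF).arrow (dart hF a) = a := (orientation hF).arrow_dart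
  simp only [EdgeOrientation.chain, darts_squareWalk, List.map_cons, List.map_nil, List.sum_cons,
    List.sum_nil, EdgeOrientation.arrow_symm, h, SquareFace.cycle_square, add_zero, add_assoc]

theorem map_cycleElement_squareWalk {σ : MG (latticeGraph F) →* PauliGroup (Qubit F)}
    (hphase : ∀ a, σ (MG.gen _ (.phase a)) = scalar _ a)
    (hedge : ∀ a, σ (MG.gen _ (.edge (dart hF a))) = operator hF a) (u : HexSource F) :
    σ (cycleElement _ (squareWalk hF u)) = 1 := by
  have hlength : ((squareWalk hF u).length : ZMod 4) = 0 := by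
    rw [← SimpleGraph.Walk.length_darts, darts_squareWalk]
    exact ZMod.natCast_self 4
  have hsymm (a : Arrow F) : σ (MG.gen _ (.edge (dart hF a).symm)) =
      scalar _ 2 * operator hF a := by
    rw [map_edge_eq_neg_symm hphase, SimpleGraph.Dart.symm_symm, hedge]
  have hneg (a b : PauliGroup (Qubit F)) :
      a * (scalar _ 2 * b) = scalar _ 2 * (a * b) := by
    rw [← mul_assoc, ← scalar_comm, mul_assoc]
  rw [cycleElement, hlength, MG.phase_zero, one_mul, darts_squareWalk]
  simp only [List.map_cons, List.map_nil, List.prod_cons, List.prod_nil, mul_one, map_mul, hedge,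
    hsymm]
  calc _ = scalar _ 2 * scalar _ 2 *
        ((operator hF (.inr u) * operator hF (.inl u.partner.1)) *
          (operator hF (.inr u.partner) * operator hF (.inl u.1))) := by
        simp only [mul_assoc, hneg]
    _ = 1 := by
        rw [operator_mul_square, scalar_mul_scalar, mul_one]
        rfl

end Arrow

end SquareCycles

/-! ## The encoding of a lattice -/

section Encoding

open PauliGroup Arrow

variable {F : Finset (Finset Vertex)} (hF : IsLattice F)
  {σ : MG (latticeGraph F) →* PauliGroup (Qubit F)}

theorem bitsMap_orientation
    (hedge : ∀ a, (σ (MG.gen _ (.edge (dart hF a)))).op = (operator hF a).op) :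
    (orientation hF).bitsMap σ = stringMap hF :=
  congrArg (Fintype.linearCombination (ZMod 2)) <| funext fun a => congrArg opBits (hedge a)

theorem IsLatticeEncoding.op_map_edge (hσ : IsLatticeEncoding F σ) (a : Arrow F) :
    (σ (MG.gen _ (.edge (dart hF a)))).op = (operator hF a).op := by
  rcases a with u | u
  · obtain ⟨s, -, h⟩ := hσ.triEdge (dart hF (.inl u)) rfl
    rw [h]
    rfl
  · obtain ⟨s, -, h⟩ := hσ.hexEdge (dart hF (.inr u)) rfl
    rw [h]
    rfl

include hF in
theorem IsLatticeEncoding.disparity_eq (hσ : IsLatticeEncoding F σ) :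
    disparity σ = -(Nat.card (latticeGraph F).ConnectedComponent : ℤ) := by
  have hrank := hσ.isEncoding.rank_stabilizerGroup_add (orientation hF)
  rw [bitsMap_orientation hF (hσ.op_map_edge hF), finrank_ker_stringMap, Fintype.card_sum,
    HexSource.card_eq] at hrank
  rw [disparity, Fintype.card_sum (β := SquareFace F)]
  omega

theorem neg_one_notMem_stabilizerGroup_of_map_edge
    (hphase : ∀ a, σ (MG.gen _ (.phase a)) = scalar _ a)
    (hedge : ∀ a, σ (MG.gen _ (.edge (dart hF a))) = operator hF a) :
    scalar _ 2 ∉ stabilizerGroup σ := by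
  refine neg_one_notMem_stabilizerGroup (orientation hF) hphase ?_
  rw [bitsMap_orientation hF fun a => congrArg op (hedge a), ker_stringMap]
  refine Submodule.span_mono ?_
  rintro _ ⟨f, rfl⟩
  obtain ⟨u, rfl⟩ := HexSource.square_surjective f
  exact ⟨_, squareWalk hF u, map_cycleElement_squareWalk hF hphase hedge u,
    (chain_squareWalk hF u).symm⟩

include hF in
theorem exists_isLatticeEncoding :
    ∃ σ : MG (latticeGraph F) →* PauliGroup (Qubit F), IsLatticeEncoding F σ := by
  obtain ⟨σ, hphase, hvertex, hedge⟩ := (orientation hF).exists_representation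
    (fun v => (⟨0, vertexString F v⟩ : PauliGroup (Qubit F))) (operator hF)
    (fun _ => mul_eq_scalar_of_op_eq rfl) (operator_mul_self hF) (form_vertexString 0 0)
    (fun a => form_operator_vertexString hF a 0) (form_operator hF)
  exact ⟨σ,
    { isEncoding := ⟨hphase, neg_one_notMem_stabilizerGroup_of_map_edge hF hphase hedge⟩
      vertex := hvertex
      hexEdge := fun d h => by
        obtain ⟨u, rfl⟩ := exists_eq_dart_inr hF h
        exact ⟨_, sign_eq (.inr u), hedge (.inr u)⟩
      triEdge := fun d h => by
        rw [eq_dart_inl hF h]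
        exact ⟨_, sign_eq (.inl d.fst), hedge (.inl d.fst)⟩ }⟩

end Encoding

end FermionEncoding

theorem mainTheorem8_general (F : Finset (Finset Vertex)) (hface : ∀ f ∈ F, IsFace f)
    (hsurr : HexagonsSurrounded F) (hmade : MadeOfHexagons F) :
    (∃ σ : MG (latticeGraph F) →* PauliGroup (Qubit F), IsLatticeEncoding F σ) ∧
      ∀ σ : MG (latticeGraph F) →* PauliGroup (Qubit F), IsLatticeEncoding F σ →
        disparity σ = -(Nat.card (latticeGraph F).ConnectedComponent : ℤ) :=
  have hF : IsLattice F := ⟨hface, hsurr, hmade⟩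
  ⟨exists_isLatticeEncoding hF, fun _ hσ => hσ.disparity_eq hF⟩

theorem mainTheorem8 (F : Finset (Finset Vertex)) (hface : ∀ f ∈ F, IsFace f)
    (hconn : (latticeGraph F).Connected) (hholes : NoHoles F)
    (hsurr : HexagonsSurrounded F) (hmade : MadeOfHexagons F) :
    (∃ σ : MG (latticeGraph F) →* PauliGroup (Qubit F), IsLatticeEncoding F σ) ∧
      ∀ σ : MG (latticeGraph F) →* PauliGroup (Qubit F),
        IsLatticeEncoding F σ → disparity σ = -1 := by
  have hcard : Nat.card (latticeGraph F).ConnectedComponent = 1 :=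
    Nat.card_eq_one_iff_unique.2 ⟨hconn.preconnected.subsingleton_connectedComponent,
      hconn.nonempty.map (latticeGraph F).connectedComponentMk⟩
  simpa only [hcard, Nat.cast_one] using mainTheorem8_general F hface hsurr hmade
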